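/- Let $n \ge 3$ and let $\mathcal{K}^n$ be the space of convex bodies (non-empty compact convex sets) in $\mathbb{R}^n$, endowed with the Hausdorff metric and with Minkowski addition. A map $f$ from $\mathcal{K}^n$ to $\mathbb{R}$ or to $\mathcal{K}^n$ is called a valuation if $f(K)+f(L)=f(K\cup L)+f(K\cap L)$ whenever $K, L, K\cup L\in\mathcal{K}^n$. Let $\mathbf{Val}$ (respectively $\mathbf{MVal}$) denote the set of continuous translation invariant valuations on $\mathcal{K}^n$ with values in $\mathbb{R}$ (respectively in $\mathcal{K}^n$). The homogeneous components of $\varphi\in\mathbf{Val}$ are the valuations $\varphi_0,\dots,\varphi_n\in\mathbf{Val}$ such that $\varphi_i(\lambda K)=\lambda^i\varphi_i(K)$ for $0\le i\le n$ and $\varphi(\lambda K)=\sum_{i=0}^n\lambda^i\varphi_i(K)$ for all $K\in\mathcal{K}^n$ and $\lambda>0$. Let $V$ denote the $n$-dimensional volume. For $K\in\mathcal{K}^n$, the following statements are equivalent: (a) For every non-negative $\varphi\in\mathbf{Val}$, its homogeneous components satisfy $\varphi_i(K)\ge 0$ for $0\le i\le n$. (b) For every $\Phi\in\mathbf{MVal}$,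 there exist $L_0,L_n\in\mathcal{K}^n$ and $\Phi_1(K),\dots,\Phi_{n-1}(K)\in\mathcal{K}^n$ such that $$\Phi(\lambda K)=L_0+\lambda\Phi_1(K)+\cdots+\lambda^{n-1}\Phi_{n-1}(K)+\lambda^nV(K)L_n\qquad\text{for every }\lambda>0.$$ Moreover, $L_0$ and $L_n$ can be chosen to depend only on $\Phi$: there are maps $L_0,L_n:\mathbf{MVal}\to\mathcal{K}^n$ such that, for every $K\in\mathcal{K}^n$, (a) is also equivalent to (b) with $L_0=L_0(\Phi)$ and $L_n=L_n(\Phi)$. -/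

import Mathlib

open MeasureTheory

/-- Convex bodies (nonempty compact convex sets) of Euclidean `n`-space, with the
Hausdorff metric, Minkowski addition and dilation. -/
abbrev Body (n : ℕ) : Type := ConvexBody (EuclideanSpace ℝ (Fin n))

/-- The one-point convex body `{x}`; thus `K + pointBody x` is the translate `K + x`. -/
def pointBody {n : ℕ} (x : EuclideanSpace ℝ (Fin n)) : Body n where
  carrier := {x}
  convex' := convex_singleton x
  isCompact' := isCompact_singleton
  nonempty' := Set.singleton_nonempty x

/-- `f` is a valuation: `f K + f L = f (K ∪ L) + f (K ∩ L)` whenever `K ∪ L` is a convex body.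
In that case `K ∩ L` is a convex body as well: it is nonempty because `K ∪ L` is connected and
`K`, `L` are closed and nonempty. Hence the quantification over `I` is no restriction. -/
def IsValuation {n : ℕ} {A : Type*} [AddCommMonoid A] (f : Body n → A) : Prop :=
  ∀ K L U I : Body n,
    (U : Set (EuclideanSpace ℝ (Fin n))) = (K : Set (EuclideanSpace ℝ (Fin n))) ∪ L →
    (I : Set (EuclideanSpace ℝ (Fin n))) = (K : Set (EuclideanSpace ℝ (Fin n))) ∩ L →
    f K + f L = f U + f I

/-- `f (K + x) = f K` for all convex bodies `K` and all vectors `x`. -/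
def IsTranslationInvariant {n : ℕ} {A : Type*} (f : Body n → A) : Prop :=
  ∀ (K : Body n) (x : EuclideanSpace ℝ (Fin n)), f (K + pointBody x) = f K

/-- Continuous translation invariant real valued valuations. -/
def Val (n : ℕ) : Set (Body n → ℝ) :=
  {φ | IsValuation φ ∧ IsTranslationInvariant φ ∧ Continuous φ}

/-- Those elements of `Val n` that are homogeneous of degree `i`. -/
def ValDeg (n i : ℕ) : Set (Body n → ℝ) :=
  {φ | φ ∈ Val n ∧ ∀ (K : Body n) (t : ℝ), 0 < t → φ (t • K) = t ^ i * φ K}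

/-- Continuous translation invariant Minkowski valuations. -/
def MVal (n : ℕ) : Set (Body n → Body n) :=
  {Φ | IsValuation Φ ∧ IsTranslationInvariant Φ ∧ Continuous Φ}

/-- `ψ 0, …, ψ n` are the homogeneous components of `φ`: each `ψ i` is in `Val n` and has
degree `i`, and `φ (t K) = ∑ t ^ i * ψ i K` for every `K` and every `t > 0`. Every `φ` in `Val n`
has exactly one such family. -/
def IsHomogeneousComponents {n : ℕ} (φ : Body n → ℝ) (ψ : Fin (n + 1) → Body n → ℝ) : Prop :=
  (∀ i : Fin (n + 1), ψ i ∈ ValDeg n i) ∧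
    ∀ (K : Body n) (t : ℝ), 0 < t → φ (t • K) = ∑ i : Fin (n + 1), t ^ (i : ℕ) * ψ i K

/-- The homogeneous components of every non-negative `φ` in `Val n` are non-negative at `K`. -/
def HasNonnegComponents {n : ℕ} (K : Body n) : Prop :=
  ∀ φ ∈ Val n, (∀ L : Body n, 0 ≤ φ L) →
    ∀ ψ : Fin (n + 1) → Body n → ℝ, IsHomogeneousComponents φ ψ → ∀ i, 0 ≤ ψ i K

/-- There are convex bodies `Ψ 1, …, Ψ (n - 1)` such that, for every `t > 0`,
`Φ (t K) = L₀ + t Ψ 1 + ⋯ + t ^ (n - 1) Ψ (n - 1) + t ^ n V(K) Lₙ`,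
with Minkowski addition and with `V` the `n`-dimensional volume. -/
def HasBodyExpansion {n : ℕ} (Φ : Body n → Body n) (K L₀ Lₙ : Body n) : Prop :=
  ∃ Ψ : ℕ → Body n, ∀ t : ℝ, 0 < t →
    Φ (t • K) = L₀ + (∑ i ∈ Finset.Icc 1 (n - 1), t ^ i • Ψ i) +
      (t ^ n * volume.real (K : Set (EuclideanSpace ℝ (Fin n)))) • Lₙ

/-! Write h(L, u) for the support function of a body L. (b) implies (a): if φ ≥ 0 and B is the unit
ball, then K ↦ φ(K)B is a Minkowski valuation. Taking widths in a fixed direction and comparing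
coefficients of powers of t, φ_i(K) times the width of B becomes the width of a convex body (times
V(K) when i = n), hence is non-negative. (a) implies (b): for fixed u, K ↦ h(Φ(K), u) is in `Val n`,
and h(Φ(K), u) + h(Φ(K), v) - h(Φ(K), u + v) is a non-negative valuation. Under (a) its components
are non-negative at K, so each component of h(Φ(·), u) at K is sublinear in u and is a support
function. The extreme terms depend only on Φ: the degree 0 component is h(Φ({0}), u), and the degree
n component is V(K) times its value at the unit cube. That value is sublinear in u unconditionally,
because the top component of a non-negative φ is the limit of φ(rK) / r^n as r → ∞.

Two classical theorems carry this. McMullen's polynomial expansion (`Val.eq_sum_homComponent`) is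
proved by induction on the dimension, with polynomiality expressed as vanishing of iterated forward
differences, a condition that survives limits and cutting. Polytopes are cut into pyramids Q with
apex 0 and base F; since (a + b)Q is the union of aQ and aF + bQ, which meet in aF, one difference
reduces Q to the lower-dimensional F. Hadwiger's theorem that degree n means a multiple of volume
(`ValDeg.eq_mul_volume`) holds because such a valuation vanishes on bodies in hyperplanes; on a fine
grid of cubes it differs from the multiple of volume only near the boundary of K, which is a null
set. -/

open scoped Pointwise RealInnerProductSpace

/-- The Euclidean space in which the convex bodies of type `Body n` live. -/
abbrev Euc (n : ℕ) : Type := EuclideanSpace ℝ (Fin n)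

/-! ### Minkowski operations, cuts and the vector space structure of `Val n` -/

section BodyBasics

variable {n : ℕ}

theorem body_dist_le {K L : Body n} {r : ℝ} (hr : 0 ≤ r)
    (h₁ : ∀ x ∈ (K : Set (Euc n)), ∃ y ∈ (L : Set (Euc n)), dist x y ≤ r)
    (h₂ : ∀ x ∈ (L : Set (Euc n)), ∃ y ∈ (K : Set (Euc n)), dist x y ≤ r) : dist K L ≤ r :=
  Metric.hausdorffDist_le_of_mem_dist hr h₁ h₂

theorem exists_dist_le_of_body_dist (K L : Body n) {x : Euc n} (hx : x ∈ (K : Set (Euc n))) :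
    ∃ y ∈ (L : Set (Euc n)), dist x y ≤ dist K L := by
  obtain ⟨y, hy, h⟩ := L.isCompact.exists_infDist_eq_dist L.nonempty x
  refine ⟨y, hy, ?_⟩
  rw [← h]
  exact Metric.infDist_le_hausdorffDist_of_mem hx ConvexBody.hausdorffEDist_ne_top

theorem coe_pointBody (x : Euc n) : ((pointBody x : Body n) : Set (Euc n)) = {x} := rfl

theorem mem_add_pointBody {K : Body n} {x y : Euc n} :
    y ∈ ((K + pointBody x : Body n) : Set (Euc n)) ↔ y - x ∈ (K : Set (Euc n)) := by
  rw [ConvexBody.coe_add, coe_pointBody, Set.add_singleton]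
  constructor
  · rintro ⟨k, hk, rfl⟩; simpa using hk
  · intro h; exact ⟨y - x, h, by simp⟩

theorem smul_add_pointBody (t : ℝ) (K : Body n) (x : Euc n) :
    t • (K + pointBody x) = t • K + pointBody (t • x) := by
  rw [smul_add]
  congr 1
  ext1
  simp [coe_pointBody]

theorem continuous_add_body (M : Body n) : Continuous fun K : Body n => K + M := by
  refine (LipschitzWith.of_dist_le_mul (K := 1) fun K L => ?_).continuous
  rw [NNReal.coe_one, one_mul]
  have key : ∀ K L : Body n, ∀ x ∈ ((K + M : Body n) : Set (Euc n)),
      ∃ y ∈ ((L + M : Body n) : Set (Euc n)), dist x y ≤ dist K L := by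
    rintro K L _ ⟨k, hk, m, hm, rfl⟩
    obtain ⟨l, hl, h⟩ := exists_dist_le_of_body_dist K L hk
    exact ⟨l + m, ⟨l, hl, m, hm, rfl⟩, by simpa using h⟩
  exact body_dist_le dist_nonneg (key K L) fun x hx => by
    simpa [dist_comm K L] using key L K x hx

theorem continuous_smul_body (t : ℝ) : Continuous fun K : Body n => t • K := by
  refine (LipschitzWith.of_dist_le_mul (K := ‖t‖₊) fun K L => ?_).continuous
  have key : ∀ K L : Body n, ∀ x ∈ ((t • K : Body n) : Set (Euc n)),
      ∃ y ∈ ((t • L : Body n) : Set (Euc n)), dist x y ≤ ‖t‖₊ * dist K L := by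
    rintro K L _ ⟨k, hk, rfl⟩
    obtain ⟨l, hl, h⟩ := exists_dist_le_of_body_dist K L hk
    refine ⟨t • l, ⟨l, hl, rfl⟩, ?_⟩
    simp only [dist_smul₀, coe_nnnorm]
    gcongr
  exact body_dist_le (by positivity) (key K L) fun x hx => by
    simpa [dist_comm K L] using key L K x hx

theorem continuous_smul_const_body (K : Body n) : Continuous fun t : ℝ => t • K := by
  obtain ⟨C, hC, hK⟩ := K.isBounded.exists_pos_norm_le
  refine (LipschitzWith.of_dist_le_mul (K := ⟨C, hC.le⟩) fun s t => ?_).continuous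
  have key : ∀ s t : ℝ, ∀ x ∈ ((s • K : Body n) : Set (Euc n)),
      ∃ y ∈ ((t • K : Body n) : Set (Euc n)), dist x y ≤ C * dist s t := by
    rintro s t _ ⟨k, hk, rfl⟩
    refine ⟨t • k, ⟨k, hk, rfl⟩, ?_⟩
    simp only [dist_eq_norm, ← sub_smul, norm_smul]
    rw [mul_comm]
    gcongr
    exact hK k hk
  exact body_dist_le (by positivity) (key s t) fun x hx => by
    rw [dist_comm s t]; exact key t s x hx

/-- If x = k + m = l + m', the segment from k to l lies in K ∪ L, so by connectedness it contains a
point z = ak + bl of K ∩ L; then x = z + (am + bm'). This is what makes K ↦ φ(K + M) a valuation. -/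
theorem add_inter_add_of_union {K L U I M : Body n}
    (hU : (U : Set (Euc n)) = (K : Set (Euc n)) ∪ L)
    (hI : (I : Set (Euc n)) = (K : Set (Euc n)) ∩ L) :
    ((I + M : Body n) : Set (Euc n)) = ((K + M : Body n) : Set (Euc n)) ∩ (L + M : Body n) := by
  simp only [ConvexBody.coe_add]
  apply Set.Subset.antisymm
  · rw [hI]; exact Set.inter_add_subset
  · rintro x ⟨⟨k, hk, m, hm, hx⟩, ⟨l, hl, m', hm', hx'⟩⟩
    simp only at hx hx'
    have hcon : IsPreconnected (segment ℝ k l) := (convex_segment k l).isPreconnected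
    have hsub : segment ℝ k l ⊆ (K : Set (Euc n)) ∪ L := by
      rw [← hU]
      exact U.convex.segment_subset (by rw [hU]; exact Or.inl hk) (by rw [hU]; exact Or.inr hl)
    obtain ⟨z, ⟨a, b, ha, hb, hab, hz⟩, hzI⟩ :=
      isPreconnected_closed_iff.1 hcon _ _ K.isClosed L.isClosed hsub
      ⟨k, left_mem_segment ℝ k l, hk⟩ ⟨l, right_mem_segment ℝ k l, hl⟩
    refine ⟨z, by rw [hI]; exact hzI, a • m + b • m', M.convex hm hm' ha hb hab, ?_⟩
    simp only
    rw [← hz]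
    calc a • k + b • l + (a • m + b • m') = a • (k + m) + b • (l + m') := by module
      _ = x := by rw [hx, hx', ← add_smul, hab, one_smul]

theorem Val.comp_add {φ : Body n → ℝ} (hφ : φ ∈ Val n) (M : Body n) :
    (fun K => φ (K + M)) ∈ Val n := by
  refine ⟨fun K L U I hU hI => ?_, fun K x => ?_, hφ.2.2.comp (continuous_add_body M)⟩
  · refine hφ.1 _ _ _ _ ?_ (add_inter_add_of_union hU hI)
    simp only [ConvexBody.coe_add, hU, Set.union_add]
  · simp only
    rw [add_right_comm, hφ.2.1]

theorem Val.comp_smul {φ : Body n → ℝ} (hφ : φ ∈ Val n) {t : ℝ} (ht : t ≠ 0) :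
    (fun K => φ (t • K)) ∈ Val n := by
  refine ⟨fun K L U I hU hI => ?_, fun K x => ?_, hφ.2.2.comp (continuous_smul_body t)⟩
  · refine hφ.1 _ _ _ _ ?_ ?_
    · simp only [ConvexBody.coe_smul, hU, Set.smul_set_union]
    · simp only [ConvexBody.coe_smul, hI, Set.smul_set_inter₀ ht]
  · simp only
    rw [smul_add_pointBody, hφ.2.1]

theorem Val.add {φ ψ : Body n → ℝ} (hφ : φ ∈ Val n) (hψ : ψ ∈ Val n) :
    (fun K => φ K + ψ K) ∈ Val n :=
  ⟨fun K L U I hU hI => by linarith [hφ.1 K L U I hU hI, hψ.1 K L U I hU hI],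
    fun K x => by simp only [hφ.2.1 K x, hψ.2.1 K x], hφ.2.2.add hψ.2.2⟩

theorem Val.const_mul {φ : Body n → ℝ} (hφ : φ ∈ Val n) (c : ℝ) :
    (fun K => c * φ K) ∈ Val n :=
  ⟨fun K L U I hU hI => by simp only [← mul_add, hφ.1 K L U I hU hI],
    fun K x => by simp only [hφ.2.1 K x], hφ.2.2.const_mul c⟩

theorem Val.sum {ι : Type*} (s : Finset ι) {φ : ι → Body n → ℝ} (hφ : ∀ i, φ i ∈ Val n) :
    (fun K => ∑ i ∈ s, φ i K) ∈ Val n := by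
  classical
  induction s using Finset.induction_on with
  | empty => exact ⟨fun _ _ _ _ _ _ => by simp, fun _ _ => by simp, by simpa using continuous_const⟩
  | insert i s hi ih => simpa [Finset.sum_insert hi] using Val.add (hφ i) ih

/-- Intersections of a convex body with closed convex sets. -/
def interBody (K : Body n) (C : Set (Euc n)) (hC : Convex ℝ C) (hC' : IsClosed C)
    (h : ((K : Set (Euc n)) ∩ C).Nonempty) : Body n :=
  ⟨K ∩ C, K.convex.inter hC, K.isCompact.inter_right hC', h⟩

theorem coe_interBody (K : Body n) (C : Set (Euc n)) (hC : Convex ℝ C) (hC' : IsClosed C)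
    (h : ((K : Set (Euc n)) ∩ C).Nonempty) :
    ((interBody K C hC hC' h : Body n) : Set (Euc n)) = (K : Set (Euc n)) ∩ C := rfl

/-- The pieces serve all valuations at once, so the identity can also be applied to K ↦ φ(tK)
without cutting tK anew. -/
theorem exists_body_cut (K : Body n) (y : Euc n) (c : ℝ)
    (h₁ : ((K : Set (Euc n)) ∩ {x | ⟪y, x⟫ ≤ c}).Nonempty)
    (h₂ : ((K : Set (Euc n)) ∩ {x | c ≤ ⟪y, x⟫}).Nonempty) :
    ∃ A B I : Body n, (A : Set (Euc n)) = (K : Set (Euc n)) ∩ {x | ⟪y, x⟫ ≤ c} ∧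
      (B : Set (Euc n)) = (K : Set (Euc n)) ∩ {x | c ≤ ⟪y, x⟫} ∧
      (I : Set (Euc n)) = (K : Set (Euc n)) ∩ {x | ⟪y, x⟫ = c} ∧
      ∀ φ ∈ Val n, φ A + φ B = φ K + φ I := by
  have hlin : IsLinearMap ℝ fun x : Euc n => ⟪y, x⟫ := (innerₛₗ ℝ y).isLinear
  have hcont : Continuous fun x : Euc n => ⟪y, x⟫ := by fun_prop
  have h₃ : ((K : Set (Euc n)) ∩ {x | ⟪y, x⟫ = c}).Nonempty := by
    obtain ⟨a, ha, ha'⟩ := h₁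
    obtain ⟨b, hb, hb'⟩ := h₂
    obtain ⟨x, hx, hx'⟩ := K.convex.isPreconnected.intermediate_value ha hb
      hcont.continuousOn ⟨ha', hb'⟩
    exact ⟨x, hx, hx'⟩
  refine ⟨interBody K _ (convex_halfSpace_le hlin c) (isClosed_le hcont continuous_const) h₁,
    interBody K _ (convex_halfSpace_ge hlin c) (isClosed_le continuous_const hcont) h₂,
    interBody K _ (convex_hyperplane hlin c) (isClosed_eq hcont continuous_const) h₃,
    rfl, rfl, rfl, fun φ hφ => hφ.1 _ _ _ _ ?_ ?_⟩
  · rw [coe_interBody, coe_interBody, ← Set.inter_union_distrib_left, eq_comm,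
      Set.inter_eq_left]
    exact fun x _ => le_total ⟪y, x⟫ c
  · rw [coe_interBody, coe_interBody, coe_interBody, ← Set.inter_inter_distrib_left]
    congr 1
    ext x
    exact le_antisymm_iff

end BodyBasics

/-! ### Vanishing forward differences and the pyramid step of McMullen's theorem -/

/-- All `k`-fold forward differences of `p` vanish on `(0, ∞)`. -/
def DiffZero (k : ℕ) (p : ℝ → ℝ) : Prop :=
  ∀ a > 0, ∀ b > 0, (fwdDiff b)^[k] p a = 0

section DiffZero

theorem fwdDiff_iter_congr_pos {p q : ℝ → ℝ} (h : ∀ t > 0, p t = q t) (k : ℕ) {a b : ℝ}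
    (ha : 0 < a) (hb : 0 < b) : (fwdDiff b)^[k] p a = (fwdDiff b)^[k] q a := by
  rw [fwdDiff_iter_eq_sum_shift, fwdDiff_iter_eq_sum_shift]
  refine Finset.sum_congr rfl fun i _ => ?_
  rw [h _ (by positivity)]

theorem DiffZero.congr {k : ℕ} {p q : ℝ → ℝ} (hp : DiffZero k p) (h : ∀ t > 0, q t = p t) :
    DiffZero k q := fun a ha b hb => by
  rw [fwdDiff_iter_congr_pos h k ha hb, hp a ha b hb]

theorem DiffZero.add {k : ℕ} {p q : ℝ → ℝ} (hp : DiffZero k p) (hq : DiffZero k q) :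
    DiffZero k fun t => p t + q t := fun a ha b hb => by
  have := congrFun (fwdDiff_iter_add b p q k) a
  simp only [Pi.add_apply, hp a ha b hb, hq a ha b hb, add_zero] at this
  exact this

theorem DiffZero.const_mul {k : ℕ} {p : ℝ → ℝ} (hp : DiffZero k p) (c : ℝ) :
    DiffZero k fun t => c * p t := fun a ha b hb => by
  have := congrFun (fwdDiff_iter_const_smul b c p k) a
  simp only [Pi.smul_apply, hp a ha b hb, smul_zero] at this
  exact this

theorem DiffZero.sub {k : ℕ} {p q : ℝ → ℝ} (hp : DiffZero k p) (hq : DiffZero k q) :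
    DiffZero k fun t => p t - q t :=
  (hp.add (hq.const_mul (-1))).congr fun t _ => by ring

theorem DiffZero.succ {k : ℕ} {p : ℝ → ℝ} (hp : DiffZero k p) : DiffZero (k + 1) p :=
  fun a ha b hb => by
    rw [Function.iterate_succ', Function.comp_apply, fwdDiff, hp a ha b hb,
      hp (a + b) (by positivity) b hb, sub_zero]

theorem DiffZero.of_const (k : ℕ) (c : ℝ) : DiffZero (k + 1) fun _ => c := by
  induction k with
  | zero => intro a _ b _; simp [fwdDiff]
  | succ k ih => exact ih.succ

theorem DiffZero.of_le {k l : ℕ} {p : ℝ → ℝ} (hp : DiffZero k p) (h : k ≤ l) : DiffZero l p := by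
  induction h with
  | refl => exact hp
  | step _ ih => exact ih.succ

/-- The comparison function q may vary with the step b, as it does for pyramids. -/
theorem DiffZero.of_fwdDiff {k : ℕ} {p : ℝ → ℝ}
    (h : ∀ b > 0, ∃ q, DiffZero k q ∧ ∀ a > 0, p (a + b) - p a = q a) : DiffZero (k + 1) p := by
  intro a ha b hb
  obtain ⟨q, hq, hpq⟩ := h b hb
  have hpq' : ∀ t > 0, fwdDiff b p t = q t := hpq
  rw [Function.iterate_succ, Function.comp_apply, fwdDiff_iter_congr_pos hpq' k ha hb,
    hq a ha b hb]

variable {n : ℕ}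

/-- Each iterated difference is a finite combination of values φ(cK), hence continuous in K. This
allows passing from polytopes to all bodies. -/
theorem isClosed_setOf_diffZero {φ : Body n → ℝ} (hφ : Continuous φ) (k : ℕ) :
    IsClosed {K : Body n | DiffZero k fun t => φ (t • K)} := by
  have : {K : Body n | DiffZero k fun t => φ (t • K)} =
      ⋂ a > (0 : ℝ), ⋂ b > (0 : ℝ), {K : Body n | (fwdDiff b)^[k] (fun t => φ (t • K)) a = 0} := by
    ext K; simp [DiffZero]
  rw [this]
  refine isClosed_biInter fun a _ => isClosed_biInter fun b _ => isClosed_eq ?_ continuous_const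
  simp only [fwdDiff_iter_eq_sum_shift]
  exact continuous_finsetSum _ fun i _ => (hφ.comp (continuous_smul_body (a + i • b))).const_smul
    ((-1 : ℤ) ^ (k - i) * (k.choose i : ℤ))

theorem DiffZero.of_add_pointBody {φ : Body n → ℝ} (hφ : φ ∈ Val n) {k : ℕ} {K : Body n}
    (x : Euc n) (h : DiffZero k fun t => φ (t • (K + pointBody x))) :
    DiffZero k fun t => φ (t • K) :=
  h.congr fun t _ => by rw [smul_add_pointBody, hφ.2.1]

theorem smul_zero_body (t : ℝ) : t • (0 : Body n) = 0 :=
  ConvexBody.ext (by rw [ConvexBody.coe_smul, ConvexBody.coe_zero, smul_zero])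

/-- The hypothesis of the induction on the dimension that proves McMullen's theorem: on bodies
in `d`-dimensional subspaces every `φ ∈ Val n` is polynomial of degree at most `d`. -/
def PolynomialInDim (n d : ℕ) : Prop :=
  ∀ W : Submodule ℝ (Euc n), Module.finrank ℝ W ≤ d → ∀ φ ∈ Val n, ∀ K : Body n,
    (K : Set (Euc n)) ⊆ W → DiffZero (d + 1) fun t => φ (t • K)

theorem PolynomialInDim.zero : PolynomialInDim n 0 := by
  intro W hW φ _ K hK
  have hW' : W = ⊥ := Submodule.finrank_eq_zero.1 (Nat.le_zero.1 hW)
  have hK0 : (K : Set (Euc n)) = 0 := by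
    refine (Set.subset_singleton_iff_eq.1 ?_).resolve_left K.nonempty.ne_empty
    simpa [hW'] using hK
  have : K = 0 := ConvexBody.ext hK0
  exact (DiffZero.of_const 0 (φ 0)).congr fun t _ => by rw [this, smul_zero_body]

theorem finrank_inf_orthogonal_lt {W : Submodule ℝ (Euc n)} {y w : Euc n} (hw : w ∈ W)
    (hyw : ⟪y, w⟫ ≠ 0) : Module.finrank ℝ ↥(W ⊓ (ℝ ∙ y)ᗮ) < Module.finrank ℝ W := by
  refine Submodule.finrank_lt_finrank_of_lt (lt_of_le_of_ne inf_le_left fun h => hyw ?_)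
  rw [← h] at hw
  exact Submodule.mem_orthogonal_singleton_iff_inner_right.1 hw.2

/-- The hypotheses make Q, unless it is {0}, a pyramid with apex 0 and base F = Q ∩ {⟪y, x⟫ = 1}.
The valuation property on (a + b)Q = aQ ∪ (aF + bQ) gives φ((a + b)Q) - φ(aQ) = φ(aF + bQ) - φ(aF).
For fixed b both terms on the right are valuations evaluated at aF, and F lies in a translate of a
space of dimension at most d. -/
theorem PolynomialInDim.pyramid {d : ℕ} (ih : PolynomialInDim n d) {W : Submodule ℝ (Euc n)}
    (hW : Module.finrank ℝ W ≤ d + 1) {φ : Body n → ℝ} (hφ : φ ∈ Val n) {Q : Body n}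
    (hQW : (Q : Set (Euc n)) ⊆ W) (h0 : 0 ∈ (Q : Set (Euc n))) {y : Euc n}
    (hy : ∀ x ∈ (Q : Set (Euc n)), x ≠ 0 →
      0 < ⟪y, x⟫ ∧ ⟪y, x⟫ ≤ 1 ∧ (⟪y, x⟫)⁻¹ • x ∈ (Q : Set (Euc n))) :
    DiffZero (d + 2) fun t => φ (t • Q) := by
  by_cases hQ : ∃ x ∈ (Q : Set (Euc n)), x ≠ 0
  swap
  · push Not at hQ
    have : Q = 0 := ConvexBody.ext <| Set.Subset.antisymm (fun x hx => hQ x hx) fun x hx => by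
      rw [ConvexBody.coe_zero] at hx; rw [Set.mem_zero.1 hx]; exact h0
    exact (DiffZero.of_const (d + 1) (φ 0)).congr fun t _ => by rw [this, smul_zero_body]
  have hlin : IsLinearMap ℝ fun x : Euc n => ⟪y, x⟫ := (innerₛₗ ℝ y).isLinear
  have hcont : Continuous fun x : Euc n => ⟪y, x⟫ := by fun_prop
  have hF : ((Q : Set (Euc n)) ∩ {x | ⟪y, x⟫ = 1}).Nonempty := by
    obtain ⟨x, hx, hx0⟩ := hQ
    obtain ⟨h1, h2, h3⟩ := hy x hx hx0
    exact ⟨_, h3, by simp [inner_smul_right, h1.ne']⟩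
  obtain ⟨f₀, hf₀⟩ := id hF
  let F : Body n := interBody Q _ (convex_hyperplane hlin 1) (isClosed_eq hcont continuous_const) hF
  have memF : ∀ x, x ∈ (F : Set (Euc n)) ↔ x ∈ (Q : Set (Euc n)) ∧ ⟪y, x⟫ = 1 := fun x => Iff.rfl
  have hsQ : ∀ x ∈ (Q : Set (Euc n)), ∀ s : ℝ, 0 ≤ s → s ≤ 1 → s • x ∈ (Q : Set (Euc n)) :=
    fun x hx s hs hs' => by
      simpa using Q.convex h0 hx (by linarith : 0 ≤ 1 - s) hs (by ring)
  have hrep : ∀ x ∈ (Q : Set (Euc n)), ∃ f ∈ (F : Set (Euc n)), x = ⟪y, x⟫ • f ∧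
      0 ≤ ⟪y, x⟫ ∧ ⟪y, x⟫ ≤ 1 := by
    intro x hx
    by_cases hx0 : x = 0
    · exact ⟨f₀, hf₀, by simp [hx0]⟩
    · obtain ⟨h1, h2, h3⟩ := hy x hx hx0
      refine ⟨_, (memF _).2 ⟨h3, by simp [inner_smul_right, h1.ne']⟩, ?_, h1.le, h2⟩
      rw [smul_smul, mul_inv_cancel₀ h1.ne', one_smul]
  have hle : ∀ x ∈ (Q : Set (Euc n)), 0 ≤ ⟪y, x⟫ ∧ ⟪y, x⟫ ≤ 1 := fun x hx =>
    let ⟨_, _, _, h1, h2⟩ := hrep x hx; ⟨h1, h2⟩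
  have hFdim : ∀ ψ ∈ Val n, DiffZero (d + 1) fun t => ψ (t • F) := by
    intro ψ hψ
    refine DiffZero.of_add_pointBody hψ (-f₀) ?_
    refine ih (W ⊓ (ℝ ∙ y)ᗮ) ?_ ψ hψ _ ?_
    · have := finrank_inf_orthogonal_lt (hQW hf₀.1) (y := y) (by
        rw [((memF _).1 hf₀).2]; exact one_ne_zero)
      omega
    · intro x hx
      rw [mem_add_pointBody, sub_neg_eq_add, memF] at hx
      refine ⟨by simpa using W.sub_mem (hQW hx.1) (hQW hf₀.1),
        Submodule.mem_orthogonal_singleton_iff_inner_right.2 ?_⟩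
      have := hx.2
      rw [inner_add_right, ((memF _).1 hf₀).2] at this
      linarith
  refine DiffZero.of_fwdDiff fun b hb => ⟨fun t => φ (t • F + b • Q) - φ (t • F),
    (hFdim _ (Val.comp_add hφ (b • Q))).sub (hFdim _ hφ), fun a ha => ?_⟩
  have key := hφ.1 (a • Q) (a • F + b • Q) ((a + b) • Q) (a • F) ?_ ?_
  · linarith
  · rw [ConvexBody.coe_add]
    simp only [ConvexBody.coe_smul]
    apply Set.Subset.antisymm
    · rintro _ ⟨x, hx, rfl⟩
      obtain ⟨f, hf, hxf, h1, h2⟩ := hrep x hx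
      simp only
      -- The height of the point (a + b)x decides the piece: up to a it lies in aQ, beyond a it is
      -- af plus a point of bQ.
      rcases le_total ((a + b) * ⟪y, x⟫) a with h | h
      · refine Or.inl ⟨((a + b) * ⟪y, x⟫ / a) • f, hsQ f ((memF _).1 hf).1 _ (by positivity)
          ((div_le_one ha).2 h), ?_⟩
        conv_rhs => rw [hxf]
        simp only [smul_smul]
        congr 1
        field_simp
      · refine Or.inr ⟨a • f, ⟨f, hf, rfl⟩, b • ((((a + b) * ⟪y, x⟫ - a) / b) • f),
          ⟨_, hsQ f ((memF _).1 hf).1 _ (div_nonneg (by linarith) hb.le)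
            ((div_le_one hb).2 (by nlinarith)), rfl⟩, ?_⟩
        conv_rhs => rw [hxf]
        simp only [smul_smul, ← add_smul]
        congr 1
        field_simp
        ring
    · rintro x (⟨q, hq, rfl⟩ | ⟨_, ⟨f, hf, rfl⟩, _, ⟨q, hq, rfl⟩, rfl⟩)
      · refine ⟨(a / (a + b)) • q, hsQ q hq _ (by positivity)
          ((div_le_one (by positivity)).2 (by linarith)), ?_⟩
        simp only [smul_smul]
        congr 1
        field_simp
      · rw [Q.convex.add_smul ha.le hb.le]
        exact ⟨_, ⟨f, ((memF _).1 hf).1, rfl⟩, _, ⟨q, hq, rfl⟩, rfl⟩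
  · rw [ConvexBody.coe_add]
    simp only [ConvexBody.coe_smul]
    apply Set.Subset.antisymm
    · rintro _ ⟨f, hf, rfl⟩
      exact ⟨⟨f, ((memF _).1 hf).1, rfl⟩, a • f, ⟨f, hf, rfl⟩, 0, ⟨0, h0, smul_zero b⟩, by simp⟩
    · rintro _ ⟨⟨q, hq, rfl⟩, ⟨_, ⟨f, hf, rfl⟩, _, ⟨q', hq', rfl⟩, h⟩⟩
      refine ⟨q, (memF _).2 ⟨hq, ?_⟩, rfl⟩
      have h1 := congrArg (fun z => ⟪y, z⟫) h
      simp only [inner_add_right, inner_smul_right, ((memF _).1 hf).2] at h1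
      have h2 := hle q hq
      have h3 := hle q' hq'
      -- On the intersection, heights in aQ are at most a and those in aF + bQ at least a, so the
      -- point has height a and lies in aF.
      nlinarith [mul_nonneg hb.le h3.1]

end DiffZero

/-! ### Approximation by polytopes and their decomposition into pyramids -/

section Polytopes

variable {n : ℕ}

/-- The points at distance exactly ε from K form a compact set, so finitely many half-spaces
containing K exclude all of them. A point of the resulting P further than ε away would have such an
excluded point on its segment to 0. -/
theorem exists_polytope_near (W : Submodule ℝ (Euc n)) {K : Body n}
    (hK : (K : Set (Euc n)) ⊆ W) (h0 : 0 ∈ (K : Set (Euc n))) {ε : ℝ} (hε : 0 < ε) :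
    ∃ (s : Finset (Euc n)) (P : Body n),
      (P : Set (Euc n)) = {x | x ∈ W ∧ ∀ y ∈ s, ⟪y, x⟫ ≤ 1} ∧ dist P K ≤ ε := by
  have hWc : IsClosed (W : Set (Euc n)) := W.closed_of_finiteDimensional
  have hdist : Continuous fun x : Euc n => Metric.infDist x (K : Set (Euc n)) :=
    Metric.continuous_infDist_pt _
  let C : Set (Euc n) := {x | Metric.infDist x (K : Set (Euc n)) = ε}
  have hCb : Bornology.IsBounded {x : Euc n | Metric.infDist x (K : Set (Euc n)) ≤ ε} := by
    obtain ⟨M, -, hM⟩ := K.isBounded.exists_pos_norm_le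
    refine isBounded_iff_forall_norm_le.2 ⟨M + ε, fun x hx => ?_⟩
    obtain ⟨k, hk, h⟩ := K.isCompact.exists_infDist_eq_dist K.nonempty x
    have h1 : ‖x‖ ≤ ‖k‖ + dist x k := by
      rw [dist_eq_norm]; exact norm_le_norm_add_norm_sub' x k
    have h2 : Metric.infDist x (K : Set (Euc n)) ≤ ε := hx
    linarith [hM k hk]
  have hC : IsCompact C := Metric.isCompact_of_isClosed_isBounded
    (isClosed_eq hdist continuous_const) (hCb.subset fun x hx => le_of_eq hx)
  have hsep : ∀ x ∈ C, ∃ y : Euc n, (∀ k ∈ (K : Set (Euc n)), ⟪y, k⟫ ≤ 1) ∧ 1 < ⟪y, x⟫ := by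
    intro x hx
    have hxK : x ∉ (K : Set (Euc n)) := fun h => by
      have : Metric.infDist x (K : Set (Euc n)) = ε := hx
      rw [Metric.infDist_zero_of_mem h] at this
      exact hε.ne this
    obtain ⟨f, u, hf, hfx⟩ := geometric_hahn_banach_closed_point K.convex K.isClosed hxK
    have hu : 0 < u := by simpa using hf 0 h0
    refine ⟨u⁻¹ • (InnerProductSpace.toDual ℝ (Euc n)).symm f, fun k hk => ?_, ?_⟩
    · rw [inner_smul_left, InnerProductSpace.toDual_symm_apply]
      simpa [inv_mul_le_iff₀ hu] using (hf k hk).le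
    · rw [inner_smul_left, InnerProductSpace.toDual_symm_apply]
      simpa [lt_inv_mul_iff₀ hu] using hfx
  obtain ⟨s, hsK, hsC⟩ : ∃ s : Finset (Euc n), (∀ y ∈ s, ∀ k ∈ (K : Set (Euc n)), ⟪y, k⟫ ≤ 1) ∧
      ∀ x ∈ C, ∃ y ∈ s, 1 < ⟪y, x⟫ := by
    classical
    choose! g hg using hsep
    obtain ⟨t, ht, htC⟩ := hC.elim_nhds_subcover (fun x => {z | 1 < ⟪g x, z⟫}) fun x hx =>
      (isOpen_lt continuous_const (by fun_prop)).mem_nhds (hg x hx).2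
    refine ⟨t.image g, fun y hy => ?_, fun x hx => ?_⟩
    · obtain ⟨x, hx, rfl⟩ := Finset.mem_image.1 hy
      exact (hg x (ht x hx)).1
    · obtain ⟨z, hz, hxz⟩ := Set.mem_iUnion₂.1 (htC hx)
      exact ⟨g z, Finset.mem_image_of_mem g hz, hxz⟩
  let P : Set (Euc n) := {x | x ∈ W ∧ ∀ y ∈ s, ⟪y, x⟫ ≤ 1}
  have hPeq : P = (W : Set (Euc n)) ∩ ⋂ y ∈ s, {x | ⟪y, x⟫ ≤ 1} := by
    ext x; simp [P]
  have hKP : (K : Set (Euc n)) ⊆ P := fun k hk => ⟨hK hk, fun y hy => hsK y hy k hk⟩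
  have hPε : ∀ z ∈ P, Metric.infDist z (K : Set (Euc n)) ≤ ε := by
    intro z hz
    by_contra! hlt
    have hcont : Continuous fun t : ℝ => Metric.infDist (t • z) (K : Set (Euc n)) := by fun_prop
    obtain ⟨t, ⟨ht0, ht1⟩, ht⟩ := intermediate_value_Icc (zero_le_one' ℝ) hcont.continuousOn
      (show ε ∈ Set.Icc _ _ by
        simp only [zero_smul, one_smul, Metric.infDist_zero_of_mem h0]
        exact ⟨hε.le, hlt.le⟩)
    obtain ⟨y, hy, hyt⟩ := hsC (t • z) ht
    rw [inner_smul_right] at hyt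
    nlinarith [hz.2 y hy]
  have hPconv : Convex ℝ P := by
    rw [hPeq]
    exact W.convex.inter (convex_iInter₂ fun y _ =>
      convex_halfSpace_le (innerₛₗ ℝ y).isLinear 1)
  have hPcl : IsClosed P := by
    rw [hPeq]
    exact hWc.inter (isClosed_biInter fun y _ => isClosed_le (by fun_prop) continuous_const)
  refine ⟨s, ⟨P, hPconv, Metric.isCompact_of_isClosed_isBounded hPcl (hCb.subset hPε),
    K.nonempty.mono hKP⟩, rfl, body_dist_le hε.le (fun x hx => ?_) fun x hx => ?_⟩
  · obtain ⟨y, hy, h⟩ := K.isCompact.exists_infDist_eq_dist K.nonempty x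
    exact ⟨y, hy, h ▸ hPε x hx⟩
  · exact ⟨x, hKP hx, by simpa using hε.le⟩

/-- The convex body `A` contains `0` and is the intersection of `P` with a cone. -/
def IsConeSection (P A : Body n) : Prop :=
  0 ∈ (A : Set (Euc n)) ∧ (A : Set (Euc n)) ⊆ P ∧
    ∀ x ∈ (A : Set (Euc n)), ∀ t : ℝ, 0 ≤ t → t • x ∈ (P : Set (Euc n)) → t • x ∈ (A : Set (Euc n))

theorem IsConeSection.of_inter {P A B : Body n} (hA : IsConeSection P A) {C : Set (Euc n)}
    (hB : (B : Set (Euc n)) = (A : Set (Euc n)) ∩ C) (h0 : 0 ∈ C)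
    (hC : ∀ x ∈ C, ∀ t : ℝ, 0 ≤ t → t • x ∈ C) : IsConeSection P B := by
  unfold IsConeSection
  rw [hB]
  exact ⟨⟨hA.1, h0⟩, fun x hx => hA.2.1 hx.1,
    fun x hx t ht h => ⟨hA.2.2 x hx.1 t ht h, hC x hx.2 t ht⟩⟩

/-- The cut identity for K ↦ φ(tK) expresses t ↦ φ(tK) linearly through the three pieces. -/
theorem DiffZero.of_cut {k : ℕ} {φ : Body n → ℝ} (hφ : φ ∈ Val n) {K A B I : Body n}
    (hcut : ∀ ψ ∈ Val n, ψ A + ψ B = ψ K + ψ I) (hA : DiffZero k fun t => φ (t • A))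
    (hB : DiffZero k fun t => φ (t • B)) (hI : DiffZero k fun t => φ (t • I)) :
    DiffZero k fun t => φ (t • K) :=
  ((hA.add hB).sub hI).congr fun t ht => by
    linarith [hcut _ (Val.comp_smul hφ (ne_of_gt ht))]

theorem PolynomialInDim.polytope {d : ℕ} (ih : PolynomialInDim n d) {W : Submodule ℝ (Euc n)}
    (hW : Module.finrank ℝ W ≤ d + 1) {φ : Body n → ℝ} (hφ : φ ∈ Val n) {P : Body n}
    {s : Finset (Euc n)} (hP : (P : Set (Euc n)) = {x | x ∈ W ∧ ∀ y ∈ s, ⟪y, x⟫ ≤ 1}) :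
    DiffZero (d + 2) fun t => φ (t • P) := by
  have memP : ∀ x, x ∈ (P : Set (Euc n)) ↔ x ∈ W ∧ ∀ y ∈ s, ⟪y, x⟫ ≤ 1 := fun x => by
    rw [hP]; rfl
  have hPW : (P : Set (Euc n)) ⊆ W := fun x hx => ((memP x).1 hx).1
  -- Otherwise the whole ray through x would lie in the bounded set P.
  have hray : ∀ x ∈ (P : Set (Euc n)), (∀ y ∈ s, ⟪y, x⟫ ≤ 0) → x = 0 := by
    intro x hx h
    by_contra hx0
    obtain ⟨C, hC, hPC⟩ := P.isBounded.exists_pos_norm_le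
    have hmem : ((C + 1) / ‖x‖) • x ∈ (P : Set (Euc n)) := (memP _).2
      ⟨W.smul_mem _ (hPW hx), fun y hy => by
        rw [inner_smul_right]
        exact (mul_nonpos_of_nonneg_of_nonpos (by positivity) (h y hy)).trans zero_le_one⟩
    have := hPC _ hmem
    rw [norm_smul, Real.norm_of_nonneg (by positivity),
      div_mul_cancel₀ _ (norm_ne_zero_iff.2 hx0)] at this
    linarith
  -- The list holds the constraints not yet compared with y₀; on A all others are dominated by y₀.
  -- Once it is empty, y₀ is the largest constraint on A, so A is a pyramid over its points with
  -- ⟪y₀, x⟫ = 1.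
  have main : ∀ (l : List (Euc n)), (∀ y ∈ l, y ∈ s) → ∀ y₀ ∈ s, ∀ A : Body n,
      IsConeSection P A → (∀ y ∈ s, y ∈ l ∨ ∀ x ∈ (A : Set (Euc n)), ⟪y, x⟫ ≤ ⟪y₀, x⟫) →
      DiffZero (d + 2) fun t => φ (t • A) := by
    intro l
    induction l with
    | nil =>
      intro _ y₀ hy₀ A hA hmax
      simp only [List.not_mem_nil, false_or] at hmax
      refine ih.pyramid hW hφ (hA.2.1.trans hPW) hA.1 (y := y₀) fun x hx hx0 => ?_
      have hxP := (memP x).1 (hA.2.1 hx)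
      have hpos : 0 < ⟪y₀, x⟫ := by
        by_contra! h
        exact hx0 (hray x (hA.2.1 hx) fun y hy => (hmax y hy x hx).trans h)
      refine ⟨hpos, hxP.2 _ hy₀, hA.2.2 x hx _ (by positivity)
        ((memP _).2 ⟨W.smul_mem _ hxP.1, fun y hy => ?_⟩)⟩
      rw [inner_smul_right, inv_mul_le_iff₀ hpos, mul_one]
      exact hmax y hy x hx
    | cons z l ihl =>
      intro hl y₀ hy₀ A hA hmax
      have hzs : z ∈ s := hl z List.mem_cons_self
      have hl' : ∀ y ∈ l, y ∈ s := fun y hy => hl y (List.mem_cons_of_mem _ hy)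
      -- The hyperplane where z and y₀ agree passes through 0: y₀ stays dominant on B, and z takes
      -- over on C.
      obtain ⟨B, C, I, hB, hC, hI, hcut⟩ := exists_body_cut A (z - y₀) 0
        ⟨0, hA.1, by simp⟩ ⟨0, hA.1, by simp⟩
      have hBd : DiffZero (d + 2) fun t => φ (t • B) := by
        refine ihl hl' y₀ hy₀ B (hA.of_inter hB (by simp) fun x hx t ht => ?_) fun y hy => ?_
        · simp only [Set.mem_ofPred_eq, inner_smul_right] at hx ⊢
          exact mul_nonpos_of_nonneg_of_nonpos ht hx
        · rw [hB]
          rcases hmax y hy with h | h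
          · rcases List.mem_cons.1 h with rfl | h
            · refine Or.inr fun x hx => ?_
              have h2 : ⟪y - y₀, x⟫ ≤ 0 := hx.2
              rw [inner_sub_left] at h2; linarith
            · exact Or.inl h
          · exact Or.inr fun x hx => h x hx.1
      have hCd : DiffZero (d + 2) fun t => φ (t • C) := by
        refine ihl hl' z hzs C (hA.of_inter hC (by simp) fun x hx t ht => ?_) fun y hy => ?_
        · simp only [Set.mem_ofPred_eq, inner_smul_right] at hx ⊢
          exact mul_nonneg ht hx
        · rw [hC]
          rcases hmax y hy with h | h
          · rcases List.mem_cons.1 h with rfl | h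
            · exact Or.inr fun x _ => le_rfl
            · exact Or.inl h
          · refine Or.inr fun x hx => (h x hx.1).trans ?_
            have h2 : 0 ≤ ⟪z - y₀, x⟫ := hx.2
            rw [inner_sub_left] at h2; linarith
      -- If z and y₀ agree on W, the section I need not drop in dimension, but then B is already all
      -- of A.
      by_cases hdeg : ∃ w ∈ W, ⟪z - y₀, w⟫ ≠ 0
      · obtain ⟨w, hw, hzw⟩ := hdeg
        refine DiffZero.of_cut hφ hcut hBd hCd
          (ih (W ⊓ (ℝ ∙ (z - y₀))ᗮ) ?_ φ hφ I fun x hx => ?_).succ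
        · have := finrank_inf_orthogonal_lt hw hzw
          omega
        · rw [hI] at hx
          exact ⟨hPW (hA.2.1 hx.1), Submodule.mem_orthogonal_singleton_iff_inner_right.2 hx.2⟩
      · push Not at hdeg
        have : B = A := ConvexBody.ext <| by
          rw [hB, Set.inter_eq_left]
          exact fun x hx => (hdeg x (hPW (hA.2.1 hx))).le
        rwa [this] at hBd
  have h0P : 0 ∈ (P : Set (Euc n)) := (memP 0).2 ⟨W.zero_mem, by simp⟩
  rcases s.eq_empty_or_nonempty with rfl | ⟨y₀, hy₀⟩
  · have : P = 0 := ConvexBody.ext <| Set.Subset.antisymm (fun x hx => hray x hx (by simp))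
      fun x hx => by rw [ConvexBody.coe_zero] at hx; rw [Set.mem_zero.1 hx]; exact h0P
    exact (DiffZero.of_const (d + 1) (φ 0)).congr fun t _ => by rw [this, smul_zero_body]
  · exact main s.toList (by simp) y₀ hy₀ P ⟨h0P, subset_rfl, fun _ _ _ _ h => h⟩ (by simp_all)

theorem polynomialInDim (n d : ℕ) : PolynomialInDim n d := by
  induction d with
  | zero => exact PolynomialInDim.zero
  | succ d ih =>
    have aux : ∀ W : Submodule ℝ (Euc n), Module.finrank ℝ W ≤ d + 1 → ∀ φ ∈ Val n, ∀ K : Body n,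
        (K : Set (Euc n)) ⊆ W → 0 ∈ (K : Set (Euc n)) → DiffZero (d + 2) fun t => φ (t • K) := by
      intro W hW φ hφ K hK h0
      have hcl := isClosed_setOf_diffZero hφ.2.2 (d + 2)
      refine hcl.closure_subset (Metric.mem_closure_iff.2 fun ε hε => ?_)
      obtain ⟨s, P, hP, hPK⟩ := exists_polytope_near W hK h0 (half_pos hε)
      exact ⟨P, ih.polytope hW hφ hP, by rw [dist_comm]; linarith⟩
    intro W hW φ hφ K hK
    obtain ⟨k, hk⟩ := K.nonempty
    refine DiffZero.of_add_pointBody hφ (-k) (aux W hW φ hφ _ (fun x hx => ?_) ?_)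
    · rw [mem_add_pointBody, sub_neg_eq_add] at hx
      simpa using W.sub_mem (hK hx) (hK hk)
    · rw [mem_add_pointBody]; simpa using hk

theorem Val.diffZero {φ : Body n → ℝ} (hφ : φ ∈ Val n) (K : Body n) :
    DiffZero (n + 1) fun t => φ (t • K) :=
  polynomialInDim n n ⊤ (by simp) φ hφ K (by simp)

end Polytopes

/-! ### From vanishing differences to polynomials; homogeneous components -/

section Homogeneous

-- Newton's forward difference formula along the progression b, 2b, 3b, …, truncated because
-- differences of order above n vanish.
open Polynomial Filter Topology in
theorem DiffZero.exists_polynomial {n : ℕ} {p : ℝ → ℝ} (hp : DiffZero (n + 1) p) {b : ℝ}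
    (hb : 0 < b) : ∃ R : ℝ[X], R.natDegree ≤ n ∧ ∀ k : ℕ, p (b + k * b) = R.eval (k : ℝ) := by
  refine ⟨∑ j ∈ Finset.range (n + 1),
    C ((fwdDiff b)^[j] p b / j.factorial) * descPochhammer ℝ j, ?_, fun k => ?_⟩
  · refine natDegree_sum_le_of_forall_le _ _ fun j hj => ?_
    refine (natDegree_C_mul_le _ _).trans ?_
    rw [descPochhammer_natDegree]
    exact Nat.lt_succ_iff.1 (Finset.mem_range.1 hj)
  · have h1 := shift_eq_sum_fwdDiff_iter b p k b
    have h2 : ∑ j ∈ Finset.range (k + 1), k.choose j • (fwdDiff b)^[j] p b =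
        ∑ j ∈ Finset.range (n + 1), k.choose j • (fwdDiff b)^[j] p b := by
      rw [Finset.sum_subset (s₂ := Finset.range (n + k + 1)),
        Finset.sum_subset (s₁ := Finset.range (n + 1)) (s₂ := Finset.range (n + k + 1))]
      · exact Finset.range_subset_range.2 (by omega)
      · intro j _ hj
        rw [Finset.mem_range, not_lt] at hj
        rw [hp.of_le hj b hb b hb, smul_zero]
      · exact Finset.range_subset_range.2 (by omega)
      · intro j _ hj
        rw [Finset.mem_range, not_lt] at hj
        rw [Nat.choose_eq_zero_of_lt (by omega), zero_smul]
    rw [nsmul_eq_mul, h2] at h1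
    rw [h1, eval_finsetSum]
    refine Finset.sum_congr rfl fun j _ => ?_
    rw [eval_mul, eval_C, nsmul_eq_mul, Nat.cast_choose_eq_descPochhammer_div]
    ring

/-- The coefficients that recover a polynomial of degree at most `n` from its values at
`1, …, n + 1`. -/
noncomputable def interpolationCoeff (n i j : ℕ) : ℝ :=
  (Lagrange.basis (Finset.range (n + 1)) (fun j : ℕ => (j : ℝ) + 1) j).coeff i

-- The interpolating polynomial through 1, …, n + 1 agrees with p on every lattice of mesh 1/N,
-- hence at all positive rationals, and everywhere by continuity.
open Polynomial Filter Topology in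
theorem DiffZero.eq_sum {n : ℕ} {p : ℝ → ℝ} (hp : DiffZero (n + 1) p)
    (hc : ContinuousOn p (Set.Ioi 0)) {t : ℝ} (ht : 0 < t) :
    p t = ∑ i ∈ Finset.range (n + 1),
      t ^ i * ∑ j ∈ Finset.range (n + 1), interpolationCoeff n i j * p (j + 1) := by
  set v : ℕ → ℝ := fun j => (j : ℝ) + 1
  have hv : Set.InjOn v (Finset.range (n + 1)) := fun i _ j _ h => by simpa [v] using h
  set P : ℝ[X] := Lagrange.interpolate (Finset.range (n + 1)) v fun j => p (j + 1)
  have hPdeg : P.degree < (n + 1 : ℕ) := by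
    have := Lagrange.degree_interpolate_lt (fun j : ℕ => p (j + 1)) hv
    rwa [Finset.card_range] at this
  have hPnat : P.natDegree < n + 1 := by
    rcases eq_or_ne P 0 with h | h
    · simp [h]
    · exact (natDegree_lt_iff_degree_lt h).2 hPdeg
  have hdeg : ∀ S : ℝ[X], S.natDegree ≤ n → S.degree < (n + 1 : ℕ) := fun S hS =>
    (degree_le_of_natDegree_le hS).trans_lt (by exact_mod_cast n.lt_succ_self)
  have hPv : ∀ j ∈ Finset.range (n + 1), P.eval (v j) = p (v j) := fun j hj =>
    Lagrange.eval_interpolate_at_node (fun j : ℕ => p (j + 1)) hv hj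
  have hrat : ∀ N k : ℕ, 0 < N → 0 < k → p (k / N) = P.eval ((k : ℝ) / N) := by
    intro N k hN hk
    have hN' : (0 : ℝ) < N := Nat.cast_pos.2 hN
    obtain ⟨R, hR, hRp⟩ := hp.exists_polynomial (b := 1 / N) (by positivity)
    have hcast : ∀ m : ℕ, 0 < m → ((m - 1 : ℕ) : ℝ) = m - 1 := fun m hm => by
      rw [Nat.cast_sub hm, Nat.cast_one]
    -- Both sides have degree at most n and agree at the n + 1 indices N(j + 1) - 1, which
    -- correspond to the points j + 1 of the lattice.
    have heq : R = P.comp (C (1 / (N : ℝ)) * X + C (1 / (N : ℝ))) := by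
      refine eq_of_degrees_lt_of_eval_index_eq (s := Finset.range (n + 1))
        (v := fun j => ((N * (j + 1) - 1 : ℕ) : ℝ)) ?_ ?_ ?_ ?_
      · intro i _ j _ h
        simp only [hcast _ (show 0 < N * (i + 1) by positivity),
          hcast _ (show 0 < N * (j + 1) by positivity)] at h
        push_cast at h
        have : (N : ℝ) * (i + 1) = N * (j + 1) := by linarith
        have := mul_left_cancel₀ hN'.ne' this
        exact_mod_cast (add_right_cancel this)
      · rw [Finset.card_range]
        exact hdeg R hR
      · rw [Finset.card_range]
        refine hdeg _ (natDegree_comp_le.trans ?_)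
        exact (Nat.mul_le_mul_left _ natDegree_linear_le).trans (by omega)
      · intro j hj
        rw [← hRp, hcast _ (show 0 < N * (j + 1) by positivity), eval_comp]
        simp only [eval_add, eval_mul, eval_C, eval_X]
        have h3 : (1 / N + (((N * (j + 1) : ℕ) : ℝ) - 1) * (1 / N) : ℝ) = v j := by
          push_cast; simp only [v]; field_simp; ring
        have h4 : (1 / N * (((N * (j + 1) : ℕ) : ℝ) - 1) + (1 / N) : ℝ) = v j := by
          rw [← h3]; ring
        rw [h3, h4, hPv j hj]
    have h5 := hRp (k - 1)
    rw [heq, eval_comp, hcast k hk] at h5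
    simp only [eval_add, eval_mul, eval_C, eval_X] at h5
    have h6 : (1 / N + ((k : ℝ) - 1) * (1 / N) : ℝ) = k / N := by ring
    have h7 : (1 / N * ((k : ℝ) - 1) + (1 / N) : ℝ) = k / N := by ring
    rwa [h6, h7] at h5
  have hpt : p t = P.eval t := by
    have hlim : Tendsto (fun N : ℕ => (⌊t * N⌋₊ : ℝ) / N) atTop (𝓝 t) :=
      (tendsto_nat_floor_mul_div_atTop ht.le).comp tendsto_natCast_atTop_atTop
    have h1 : Tendsto (fun N : ℕ => p ((⌊t * N⌋₊ : ℝ) / N)) atTop (𝓝 (p t)) :=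
      (hc.continuousAt (Ioi_mem_nhds ht)).tendsto.comp hlim
    have h2 : Tendsto (fun N : ℕ => P.eval ((⌊t * N⌋₊ : ℝ) / N)) atTop (𝓝 (P.eval t)) :=
      (P.continuous.tendsto t).comp hlim
    refine tendsto_nhds_unique h1 (h2.congr' ?_)
    filter_upwards [hlim.eventually (Ioi_mem_nhds ht), eventually_gt_atTop 0] with N hN hN0
    refine (hrat N _ hN0 (Nat.pos_of_ne_zero fun h => ?_)).symm
    simp [h] at hN
  rw [hpt, eval_eq_sum_range' hPnat]
  refine Finset.sum_congr rfl fun i _ => ?_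
  rw [mul_comm]
  congr 1
  simp only [P, Lagrange.interpolate_apply, finsetSum_coeff, coeff_C_mul, interpolationCoeff]
  exact Finset.sum_congr rfl fun j _ => mul_comm _ _

open Polynomial in
theorem coeff_eq_of_eval_eq {n : ℕ} {a b : ℕ → ℝ}
    (h : ∀ t : ℝ, 0 < t → ∑ i ∈ Finset.range (n + 1), t ^ i * a i =
      ∑ i ∈ Finset.range (n + 1), t ^ i * b i) {i : ℕ} (hi : i ≤ n) : a i = b i := by
  have key : ∑ i ∈ Finset.range (n + 1), C (a i) * X ^ i =
      ∑ i ∈ Finset.range (n + 1), C (b i) * X ^ i := by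
    refine eq_of_infinite_eval_eq _ _ ((Set.Ioi_infinite (0 : ℝ)).mono fun t ht => ?_)
    simpa only [Set.mem_ofPred_eq, eval_finsetSum, eval_mul, eval_C, eval_pow, eval_X,
      mul_comm] using h t ht
  have := congrArg (fun P => coeff P i) key
  simpa [finsetSum_coeff, coeff_C_mul, coeff_X_pow, Nat.lt_succ_iff, hi] using this

variable {n : ℕ}

/-- The homogeneous component of degree `i` of `φ`. -/
noncomputable def homComponent (i : ℕ) (φ : Body n → ℝ) (K : Body n) : ℝ :=
  ∑ j ∈ Finset.range (n + 1), interpolationCoeff n i j * φ (((j : ℝ) + 1) • K)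

theorem Val.eq_sum_homComponent {φ : Body n → ℝ} (hφ : φ ∈ Val n) (K : Body n) {t : ℝ}
    (ht : 0 < t) :
    φ (t • K) = ∑ i ∈ Finset.range (n + 1), t ^ i * homComponent i φ K :=
  (Val.diffZero hφ K).eq_sum (hφ.2.2.comp (continuous_smul_const_body K)).continuousOn ht

theorem Val.homComponent_mem {φ : Body n → ℝ} (hφ : φ ∈ Val n) (i : ℕ) :
    homComponent i φ ∈ Val n :=
  Val.sum _ fun j => Val.const_mul (Val.comp_smul hφ (by positivity)) _

/-- Expand φ(stK) in s in two ways and compare coefficients. -/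
theorem Val.homComponent_smul {φ : Body n → ℝ} (hφ : φ ∈ Val n) {i : ℕ} (hi : i ≤ n) (K : Body n)
    {t : ℝ} (ht : 0 < t) : homComponent i φ (t • K) = t ^ i * homComponent i φ K := by
  refine coeff_eq_of_eval_eq (n := n) (a := fun i => homComponent i φ (t • K))
    (b := fun i => t ^ i * homComponent i φ K) (fun s hs => ?_) hi
  rw [← Val.eq_sum_homComponent hφ (t • K) hs, smul_smul,
    Val.eq_sum_homComponent hφ K (mul_pos hs ht)]
  refine Finset.sum_congr rfl fun i _ => ?_
  rw [mul_pow]; ring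

theorem Val.homComponent_mem_valDeg {φ : Body n → ℝ} (hφ : φ ∈ Val n) {i : ℕ} (hi : i ≤ n) :
    homComponent i φ ∈ ValDeg n i :=
  ⟨Val.homComponent_mem hφ i, fun K _ ht => Val.homComponent_smul hφ hi K ht⟩

theorem Val.isHomogeneousComponents {φ : Body n → ℝ} (hφ : φ ∈ Val n) :
    IsHomogeneousComponents φ fun i : Fin (n + 1) => homComponent i φ :=
  ⟨fun i => Val.homComponent_mem_valDeg hφ (Nat.lt_succ_iff.1 i.2), fun K t ht => by
    rw [Val.eq_sum_homComponent hφ K ht, Finset.sum_range]⟩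

theorem homComponent_add (i : ℕ) (φ ψ : Body n → ℝ) (K : Body n) :
    homComponent i (fun K => φ K + ψ K) K = homComponent i φ K + homComponent i ψ K := by
  simp only [homComponent, mul_add, Finset.sum_add_distrib]

theorem homComponent_const_mul (i : ℕ) (c : ℝ) (φ : Body n → ℝ) (K : Body n) :
    homComponent i (fun K => c * φ K) K = c * homComponent i φ K := by
  simp only [homComponent, Finset.mul_sum, mul_left_comm]

open Filter Topology in
theorem Val.homComponent_zero {φ : Body n → ℝ} (hφ : φ ∈ Val n) (K : Body n) :
    homComponent 0 φ K = φ 0 := by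
  have h0 : (0 : ℝ) • K = 0 := ConvexBody.ext (by
    rw [ConvexBody.coe_smul, ConvexBody.coe_zero, Set.zero_smul_set K.nonempty])
  have h1 : Tendsto (fun t : ℝ => φ (t • K)) (𝓝[>] 0) (𝓝 (φ 0)) := by
    have := (hφ.2.2.comp (continuous_smul_const_body K)).tendsto 0
    simp only [Function.comp_apply, h0] at this
    exact this.mono_left nhdsWithin_le_nhds
  have h2 : Tendsto (fun t : ℝ => ∑ i ∈ Finset.range (n + 1), t ^ i * homComponent i φ K)
      (𝓝[>] 0) (𝓝 (homComponent 0 φ K)) := by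
    have hc : Continuous fun t : ℝ =>
      ∑ i ∈ Finset.range (n + 1), t ^ i * homComponent i φ K := by fun_prop
    have := hc.tendsto 0
    rw [Finset.sum_eq_single_of_mem 0 (by simp) fun i _ hi => by simp [hi], pow_zero,
      one_mul] at this
    exact this.mono_left nhdsWithin_le_nhds
  refine tendsto_nhds_unique h2 (h1.congr' ?_)
  filter_upwards [self_mem_nhdsWithin] with t ht
  exact Val.eq_sum_homComponent hφ K ht

end Homogeneous

/-! ### Compactness, cuts of degree n valuations and of volume, boxes -/

section Volume

variable {n : ℕ}

open Filter Topology in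
/-- Blaschke selection: a sequence of bodies in a compact set has a convergent subsequence. -/
theorem exists_body_tendsto_subseq {Q : Set (Euc n)} (hQ : IsCompact Q) (K : ℕ → Body n)
    (hK : ∀ m, (K m : Set (Euc n)) ⊆ Q) :
    ∃ (L : Body n) (f : ℕ → ℕ), StrictMono f ∧ Tendsto (fun m => K (f m)) atTop (𝓝 L) := by
  let S : ℕ → TopologicalSpace.NonemptyCompacts (Euc n) :=
    fun m => ⟨⟨K m, (K m).isCompact⟩, (K m).nonempty⟩
  obtain ⟨L, -, f, hf, hL⟩ :=
    (TopologicalSpace.NonemptyCompacts.isCompact_subsets_of_isCompact hQ).tendsto_subseq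
      (x := S) hK
  have hlim : Tendsto (fun m => Metric.hausdorffDist (K (f m) : Set (Euc n)) L) atTop (𝓝 0) :=
    tendsto_iff_dist_tendsto_zero.1 hL
  have hne : ∀ m, Metric.hausdorffEDist (K m : Set (Euc n)) L ≠ ⊤ := fun m =>
    Metric.hausdorffEDist_ne_top_of_nonempty_of_bounded (K m).nonempty L.nonempty
      (K m).isBounded L.isCompact.isBounded
  -- Compactness only supplies a compact limit set; its convexity is inherited by approximating
  -- points of L by points of the convex bodies.
  have hconv : Convex ℝ (L : Set (Euc n)) := by
    intro x hx y hy a b ha hb hab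
    rw [← L.isCompact.isClosed.closure_eq, Metric.mem_closure_iff]
    intro ε hε
    obtain ⟨m, hm⟩ := (hlim.eventually (gt_mem_nhds (half_pos hε))).exists
    obtain ⟨x', hx', hxd⟩ := Metric.exists_dist_lt_of_hausdorffDist_lt' hx hm (hne _)
    obtain ⟨y', hy', hyd⟩ := Metric.exists_dist_lt_of_hausdorffDist_lt' hy hm (hne _)
    obtain ⟨z, hz, hzd⟩ := Metric.exists_dist_lt_of_hausdorffDist_lt
      ((K (f m)).convex hx' hy' ha hb hab) hm (hne _)
    refine ⟨z, hz, ?_⟩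
    have h1 : dist (a • x + b • y) (a • x' + b • y') ≤ a * dist x x' + b * dist y y' := by
      refine (dist_add_add_le _ _ _ _).trans ?_
      rw [dist_smul₀, dist_smul₀, Real.norm_of_nonneg ha, Real.norm_of_nonneg hb]
    rw [dist_comm x' x] at hxd
    rw [dist_comm y' y] at hyd
    have h2 : a * dist x x' + b * dist y y' ≤ a * (ε / 2) + b * (ε / 2) := by gcongr
    have h3 : a * (ε / 2) + b * (ε / 2) = ε / 2 := by rw [← add_mul, hab, one_mul]
    linarith [dist_triangle (a • x + b • y) (a • x' + b • y') z]
  exact ⟨⟨L, hconv, L.isCompact, L.nonempty⟩, f, hf, tendsto_iff_dist_tendsto_zero.2 hlim⟩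

/-- Values tending to infinity would contradict continuity at the limit of a Blaschke subsequence.
-/
theorem exists_abs_le_of_continuous {φ : Body n → ℝ} (hφ : Continuous φ) {Q : Set (Euc n)}
    (hQ : IsCompact Q) : ∃ M, 0 ≤ M ∧ ∀ K : Body n, (K : Set (Euc n)) ⊆ Q → |φ K| ≤ M := by
  by_contra! h
  choose K hK hKm using fun m : ℕ => h m m.cast_nonneg
  obtain ⟨L, f, hf, hL⟩ := exists_body_tendsto_subseq hQ K hK
  have h1 := ((hφ.abs.tendsto L).comp hL).eventually (gt_mem_nhds (lt_add_one |φ L|))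
  obtain ⟨N, hN⟩ := exists_nat_gt (|φ L| + 1)
  obtain ⟨m, hm, hm'⟩ := (h1.and (Filter.eventually_ge_atTop N)).exists
  have h2 := hKm (f m)
  have h3 : (N : ℝ) ≤ f m := by exact_mod_cast hm'.trans hf.le_apply
  simp only [Function.comp_apply] at hm
  linarith

/-- By the dimension bound, t ↦ φ(tI) = t ^ n φ(I) has vanishing n-th differences, but the n-th
difference of t ^ n with step 1 is n!. -/
theorem ValDeg.eq_zero_of_hyperplane {φ : Body n → ℝ} (hφ : φ ∈ ValDeg n n) {y : Euc n}
    (hy : y ≠ 0) {c : ℝ} {I : Body n} (hI : ∀ x ∈ (I : Set (Euc n)), ⟪y, x⟫ = c) : φ I = 0 := by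
  obtain ⟨x₀, hx₀⟩ := I.nonempty
  have hlt := finrank_inf_orthogonal_lt (W := ⊤) (y := y) (w := y) trivial
    (by rwa [ne_eq, inner_self_eq_zero])
  rw [finrank_top, finrank_euclideanSpace_fin] at hlt
  obtain ⟨m, rfl⟩ : ∃ m, n = m + 1 := ⟨n - 1, by omega⟩
  have h1 : DiffZero (m + 1) fun t => φ (t • I) := by
    refine DiffZero.of_add_pointBody hφ.1 (-x₀) (polynomialInDim _ m _ (Nat.lt_succ_iff.1 hlt)
      φ hφ.1 _ fun x hx => ?_)
    rw [mem_add_pointBody, sub_neg_eq_add] at hx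
    refine ⟨trivial, Submodule.mem_orthogonal_singleton_iff_inner_right.2 ?_⟩
    have h2 := hI _ hx
    rw [inner_add_right, hI x₀ hx₀] at h2
    linarith
  have h2 : DiffZero (m + 1) fun t => φ I * t ^ (m + 1) :=
    h1.congr fun t ht => by rw [hφ.2 I t ht, mul_comm]
  have h3 := h2 1 one_pos 1 one_pos
  have h4 := congrFun (fwdDiff_iter_const_smul (1 : ℝ) (φ I) (fun r : ℝ => r ^ (m + 1)) (m + 1)) 1
  rw [fwdDiff_iter_eq_factorial] at h4
  have h5 : φ I * ((m + 1).factorial : ℝ) = 0 := h4.symm.trans h3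
  exact (mul_eq_zero.1 h5).resolve_right (by positivity)

open Classical in
/-- The extension of `φ` by zero to all subsets that are not convex bodies. -/
noncomputable def extendZero (φ : Body n → ℝ) (A : Set (Euc n)) : ℝ :=
  if h : Convex ℝ A ∧ IsCompact A ∧ A.Nonempty then φ ⟨A, h.1, h.2.1, h.2.2⟩ else 0

theorem extendZero_coe (φ : Body n → ℝ) (K : Body n) : extendZero φ (K : Set (Euc n)) = φ K := by
  rw [extendZero, dif_pos ⟨K.convex, K.isCompact, K.nonempty⟩]
  rfl

theorem extendZero_empty (φ : Body n → ℝ) : extendZero φ ∅ = 0 := by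
  rw [extendZero, dif_neg (by simp)]

/-- The common face lies in a hyperplane and contributes nothing; the value 0 at the empty set
covers hyperplanes that miss A. -/
theorem extendZero_cut {φ : Body n → ℝ} (hφ : φ ∈ ValDeg n n) {y : Euc n} (hy : y ≠ 0) (c : ℝ)
    {A : Set (Euc n)} (hA : Convex ℝ A) (hA' : IsCompact A) :
    extendZero φ A = extendZero φ (A ∩ {x | ⟪y, x⟫ ≤ c}) + extendZero φ (A ∩ {x | c ≤ ⟪y, x⟫}) := by
  rcases A.eq_empty_or_nonempty with rfl | hne
  · simp [extendZero_empty]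
  let K : Body n := ⟨A, hA, hA', hne⟩
  rcases (A ∩ {x | ⟪y, x⟫ ≤ c}).eq_empty_or_nonempty with h₁ | h₁
  · have h₂ : A ∩ {x | c ≤ ⟪y, x⟫} = A := Set.inter_eq_left.2 fun x hx =>
      show c ≤ ⟪y, x⟫ from
        le_of_not_ge fun h => Set.eq_empty_iff_forall_notMem.1 h₁ x ⟨hx, h⟩
    rw [h₁, h₂, extendZero_empty, zero_add]
  rcases (A ∩ {x | c ≤ ⟪y, x⟫}).eq_empty_or_nonempty with h₂ | h₂
  · have h₁ : A ∩ {x | ⟪y, x⟫ ≤ c} = A := Set.inter_eq_left.2 fun x hx =>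
      show ⟪y, x⟫ ≤ c from
        le_of_not_ge fun h => Set.eq_empty_iff_forall_notMem.1 h₂ x ⟨hx, h⟩
    rw [h₁, h₂, extendZero_empty, add_zero]
  obtain ⟨B, C, I, hB, hC, hI, hcut⟩ := exists_body_cut K y c h₁ h₂
  have h1 := hcut φ hφ.1
  rw [ValDeg.eq_zero_of_hyperplane hφ hy (I := I) (c := c) fun x hx => by
    rw [hI] at hx; exact hx.2, add_zero] at h1
  have h2 : (A : Set (Euc n)) = (K : Set (Euc n)) := rfl
  rw [h2, ← hB, ← hC, extendZero_coe, extendZero_coe, extendZero_coe, h1]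

theorem volume_hyperplane {y : Euc n} (hy : y ≠ 0) (c : ℝ) :
    volume {x : Euc n | ⟪y, x⟫ = c} = 0 := by
  rcases {x : Euc n | ⟪y, x⟫ = c}.eq_empty_or_nonempty with h | ⟨x₀, hx₀⟩
  · rw [h, measure_empty]
  · have h1 : (ℝ ∙ y)ᗮ ≠ ⊤ := fun h => hy <| by
      have : y ∈ (ℝ ∙ y)ᗮ := h ▸ trivial
      rwa [Submodule.mem_orthogonal_singleton_iff_inner_right, inner_self_eq_zero] at this
    have h2 := Measure.addHaar_submodule (volume : Measure (Euc n)) _ h1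
    rw [← measure_preimage_add_right volume (-x₀)] at h2
    refine measure_mono_null (fun x hx => ?_) h2
    have h3 : ⟪y, x⟫ = c := hx
    have h4 : ⟪y, x₀⟫ = c := hx₀
    refine Submodule.mem_orthogonal_singleton_iff_inner_right.2 ?_
    rw [inner_add_right, inner_neg_right, h3, h4, add_neg_cancel]

theorem volume_real_cut {y : Euc n} (hy : y ≠ 0) (c : ℝ) {A : Set (Euc n)}
    (hA : MeasurableSet A) (hA' : volume A ≠ ⊤) :
    volume.real A = volume.real (A ∩ {x | ⟪y, x⟫ ≤ c}) + volume.real (A ∩ {x | c ≤ ⟪y, x⟫}) := by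
  have hm : MeasurableSet {x : Euc n | c ≤ ⟪y, x⟫} :=
    (isClosed_le continuous_const (by fun_prop)).measurableSet
  have h1 := measureReal_union_add_inter (μ := volume) (s := A ∩ {x | ⟪y, x⟫ ≤ c})
    (hA.inter hm) (measure_ne_top_of_subset Set.inter_subset_left hA')
    (measure_ne_top_of_subset Set.inter_subset_left hA')
  have h2 : A ∩ {x | ⟪y, x⟫ ≤ c} ∪ A ∩ {x | c ≤ ⟪y, x⟫} = A := by
    rw [← Set.inter_union_distrib_left, Set.inter_eq_left]
    exact fun x _ => le_total ⟪y, x⟫ c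
  have h3 : volume.real (A ∩ {x | ⟪y, x⟫ ≤ c} ∩ (A ∩ {x | c ≤ ⟪y, x⟫})) = 0 := by
    rw [measureReal_def, measure_mono_null (fun x hx => ?_) (volume_hyperplane hy c),
      ENNReal.toReal_zero]
    exact le_antisymm hx.1.2 hx.2.2
  rw [← h1, h2, h3, add_zero]

/-- The axis-parallel box with lower corner `a` and side lengths `r`. -/
def box (a r : Fin n → ℝ) : Set (Euc n) := {x | ∀ i, a i ≤ x i ∧ x i ≤ a i + r i}

theorem box_eq_preimage (a r : Fin n → ℝ) :
    box a r = (WithLp.ofLp : Euc n → Fin n → ℝ) ⁻¹' Set.Icc a (a + r) := by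
  ext x
  simp [box, Set.mem_Icc, Pi.le_def, forall_and]

theorem isClosed_box (a r : Fin n → ℝ) : IsClosed (box a r) := by
  rw [box_eq_preimage]
  exact isClosed_Icc.preimage (PiLp.continuous_ofLp 2 _)

theorem convex_box (a r : Fin n → ℝ) : Convex ℝ (box a r) := by
  rw [box_eq_preimage]
  exact (convex_Icc a (a + r)).is_linear_preimage ⟨fun _ _ => rfl, fun _ _ => rfl⟩

theorem dist_le_of_mem_box {a : Fin n → ℝ} {r : ℝ} (hr : 0 ≤ r) {x y : Euc n}
    (hx : x ∈ box a fun _ => r) (hy : y ∈ box a fun _ => r) : dist x y ≤ n * r := by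
  rw [EuclideanSpace.dist_eq]
  refine Real.sqrt_le_iff.2 ⟨by positivity, ?_⟩
  calc ∑ i, dist (x i) (y i) ^ 2 ≤ ∑ _i : Fin n, r ^ 2 := by
        refine Finset.sum_le_sum fun i _ => pow_le_pow_left₀ dist_nonneg ?_ 2
        rw [Real.dist_eq, abs_le]
        constructor <;> linarith [(hx i).1, (hx i).2, (hy i).1, (hy i).2]
    _ = n * r ^ 2 := by simp
    _ ≤ (n * r) ^ 2 := by
        rw [mul_pow]
        gcongr
        exact_mod_cast Nat.le_self_pow two_ne_zero n

theorem isCompact_box (a r : Fin n → ℝ) : IsCompact (box a r) := by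
  rw [box_eq_preimage]
  exact (EuclideanSpace.equiv (Fin n) ℝ).toHomeomorph.isCompact_preimage.2 isCompact_Icc

theorem volume_real_box (a : Fin n → ℝ) {r : ℝ} (hr : 0 ≤ r) :
    volume.real (box a fun _ => r) = r ^ n := by
  rw [box_eq_preimage, measureReal_def,
    (PiLp.volume_preserving_ofLp (Fin n)).measure_preimage measurableSet_Icc.nullMeasurableSet,
    Real.volume_Icc_pi]
  simp [ENNReal.toReal_ofReal hr]

theorem single_one_ne_zero (i : Fin n) : (EuclideanSpace.single i 1 : Euc n) ≠ 0 := by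
  simp

theorem inner_single_one (i : Fin n) (x : Euc n) : ⟪EuclideanSpace.single i (1 : ℝ), x⟫ = x i := by
  simp [EuclideanSpace.inner_single_left]

open Classical in
theorem box_cut_le (a : Fin n → ℝ) {r : ℝ} (hr : 0 ≤ r) (s : Finset (Fin n)) {i : Fin n}
    (hi : i ∉ s) :
    (box a fun j => if j ∈ insert i s then 2 * r else r) ∩
      {x | ⟪EuclideanSpace.single i (1 : ℝ), x⟫ ≤ a i + r} =
      box a fun j => if j ∈ s then 2 * r else r := by
  ext x
  simp only [box, inner_single_one, Set.mem_inter_iff, Set.mem_ofPred_eq, Finset.mem_insert]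
  constructor
  · rintro ⟨h, h'⟩ j
    have := h j
    by_cases hj : j = i
    · subst hj; simp only [hi, if_false]; exact ⟨this.1, h'⟩
    · simpa [hj] using this
  · intro h
    refine ⟨fun j => ?_, by simpa [hi] using (h i).2⟩
    have := h j
    by_cases hj : j = i
    · subst hj
      simp only [hi, if_false] at this
      simp only [true_or, if_true]
      exact ⟨this.1, by linarith⟩
    · simpa [hj] using this

open Classical in
theorem box_cut_ge (a : Fin n → ℝ) {r : ℝ} (hr : 0 ≤ r) (s : Finset (Fin n)) {i : Fin n}
    (hi : i ∉ s) :
    (box a fun j => if j ∈ insert i s then 2 * r else r) ∩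
      {x | a i + r ≤ ⟪EuclideanSpace.single i (1 : ℝ), x⟫} =
      box (Function.update a i (a i + r)) fun j => if j ∈ s then 2 * r else r := by
  ext x
  simp only [box, inner_single_one, Set.mem_inter_iff, Set.mem_ofPred_eq, Finset.mem_insert]
  constructor
  · rintro ⟨h, h'⟩ j
    have := h j
    by_cases hj : j = i
    · subst hj
      simp only [true_or, if_true] at this
      simp only [hi, if_false, Function.update_self]
      exact ⟨h', by linarith⟩
    · simpa [hj] using this
  · intro h
    refine ⟨fun j => ?_, by simpa using (h i).1⟩
    have := h j
    by_cases hj : j = i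
    · subst hj
      simp only [hi, if_false, Function.update_self] at this
      simp only [true_or, if_true]
      constructor <;> linarith
    · simpa [hj] using this

open Classical in
/-- A property of boxes that passes from the two halves to the whole holds for all cubes of
side `2 ^ k * r` if it holds for all cubes of side `r`. -/
theorem cube_induction {G : Set (Euc n) → Prop}
    (hG : ∀ (a b : Fin n → ℝ) (i : Fin n) (c : ℝ),
      G (box a b ∩ {x | ⟪EuclideanSpace.single i (1 : ℝ), x⟫ ≤ c}) →
      G (box a b ∩ {x | c ≤ ⟪EuclideanSpace.single i (1 : ℝ), x⟫}) → G (box a b))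
    {r : ℝ} (hr : 0 ≤ r) (h : ∀ a : Fin n → ℝ, G (box a fun _ => r)) (k : ℕ) :
    ∀ a : Fin n → ℝ, G (box a fun _ => 2 ^ k * r) := by
  induction k with
  | zero => simpa using h
  | succ k ih =>
    -- Sides are doubled one coordinate at a time; s records those already doubled.
    have key : ∀ (s : Finset (Fin n)) (a : Fin n → ℝ),
        G (box a fun j => if j ∈ s then 2 * (2 ^ k * r) else 2 ^ k * r) := by
      intro s
      induction s using Finset.induction_on with
      | empty => simpa using ih
      | insert i s hi ihs =>
        intro a
        refine hG _ _ i (a i + 2 ^ k * r) ?_ ?_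
        · rw [box_cut_le a (by positivity) s hi]; exact ihs a
        · rw [box_cut_ge a (by positivity) s hi]; exact ihs _
    intro a
    have := key Finset.univ a
    simp only [Finset.mem_univ, if_true] at this
    rwa [pow_succ', mul_assoc]

end Volume

/-! ### Degree n valuations are multiples of the volume -/

section TopDegree

variable {n : ℕ}

/-- The unit cube. -/
def unitCube (n : ℕ) : Body n :=
  ⟨box 0 fun _ => 1, convex_box _ _, isCompact_box _ _, ⟨0, fun i => by simp⟩⟩

theorem coe_unitCube : (unitCube n : Set (Euc n)) = box 0 fun _ => 1 := rfl

theorem mem_box_iff {a : Fin n → ℝ} {r : ℝ} (hr : 0 < r) {x : Euc n} :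
    x ∈ box a (fun _ => r) ↔ r⁻¹ • (x - WithLp.toLp 2 a) ∈ (unitCube n : Set (Euc n)) := by
  rw [coe_unitCube]
  refine forall_congr' fun i => ?_
  simp only [PiLp.smul_apply, PiLp.sub_apply, smul_eq_mul, Pi.zero_apply, zero_add]
  rw [inv_mul_le_iff₀ hr, mul_one]
  refine and_congr ⟨fun h => by have : 0 ≤ x i - a i := by linarith
                                positivity, fun h => ?_⟩ ⟨fun h => by linarith, fun h => by linarith⟩
  have := (mul_nonneg_iff_of_pos_left (inv_pos.2 hr)).1 h
  linarith

theorem ValDeg.eq_pow_mul {φ : Body n → ℝ} (hφ : φ ∈ ValDeg n n) (L : Body n) (a : Fin n → ℝ)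
    {r : ℝ} (hr : 0 < r) :
    φ L = r ^ n * φ (r⁻¹ • (L + pointBody (-WithLp.toLp 2 a))) := by
  rw [← hφ.2 _ r hr, smul_smul, mul_inv_cancel₀ hr.ne', one_smul, hφ.1.2.1]

theorem mem_smul_add_pointBody {L : Body n} {a x : Euc n} {r : ℝ} (hr : 0 < r) :
    x ∈ ((r⁻¹ • (L + pointBody (-a)) : Body n) : Set (Euc n)) ↔
      r • x + a ∈ (L : Set (Euc n)) := by
  rw [ConvexBody.coe_smul, Set.mem_inv_smul_set_iff₀ hr.ne', mem_add_pointBody, sub_neg_eq_add]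

theorem ValDeg.box_eq {φ : Body n → ℝ} (hφ : φ ∈ ValDeg n n) (a : Fin n → ℝ) {r : ℝ}
    (hr : 0 < r) : extendZero φ (box a fun _ => r) = r ^ n * φ (unitCube n) := by
  have hne : (box a fun _ => r).Nonempty := ⟨WithLp.toLp 2 a, fun i => by simp [hr.le]⟩
  let L : Body n := ⟨box a fun _ => r, convex_box _ _, isCompact_box _ _, hne⟩
  have h1 : extendZero φ (box a fun _ => r) = φ L := extendZero_coe φ L
  rw [h1, ValDeg.eq_pow_mul hφ L a hr]
  congr 2
  ext x
  rw [mem_smul_add_pointBody hr]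
  change r • x + WithLp.toLp 2 a ∈ box a (fun _ => r) ↔ _
  rw [mem_box_iff hr, add_sub_cancel_right, smul_smul, inv_mul_cancel₀ hr.ne', one_smul]

/-- Homogeneity and translation invariance rescale the cube to the unit cube, so a small cube costs
no more than a multiple of its volume. -/
theorem ValDeg.abs_extendZero_le {φ : Body n → ℝ} (hφ : φ ∈ ValDeg n n) {M : ℝ} (hM0 : 0 ≤ M)
    (hM : ∀ K : Body n, (K : Set (Euc n)) ⊆ unitCube n → |φ K| ≤ M) {a : Fin n → ℝ} {r : ℝ}
    (hr : 0 < r) {A : Set (Euc n)} (hA : A ⊆ box a fun _ => r) :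
    |extendZero φ A| ≤ r ^ n * M := by
  rw [extendZero]
  split_ifs with h
  · rw [ValDeg.eq_pow_mul hφ _ a hr, abs_mul, abs_of_nonneg (by positivity)]
    gcongr
    refine hM _ fun x hx => ?_
    rw [mem_smul_add_pointBody hr] at hx
    have := (mem_box_iff hr).1 (hA hx)
    rwa [add_sub_cancel_right, smul_smul, inv_mul_cancel₀ hr.ne', one_smul] at this
  · rw [abs_zero]; positivity

/-- Otherwise the interior and the complement of K would disconnect B. -/
theorem inter_frontier_nonempty {K : Body n} {B : Set (Euc n)} (hB : IsPreconnected B)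
    (h₁ : (B ∩ K).Nonempty) (h₂ : ¬ B ⊆ (K : Set (Euc n))) :
    (B ∩ frontier (K : Set (Euc n))).Nonempty := by
  by_contra hcon
  rw [Set.not_nonempty_iff_eq_empty] at hcon
  have hint : ∀ x ∈ B, x ∈ (K : Set (Euc n)) → x ∈ interior (K : Set (Euc n)) := by
    intro x hx hxK
    by_contra hxi
    refine Set.eq_empty_iff_forall_notMem.1 hcon x ⟨hx, ?_⟩
    rw [K.isClosed.frontier_eq]
    exact ⟨hxK, hxi⟩
  obtain ⟨z, hz, hzK⟩ := Set.not_subset.1 h₂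
  obtain ⟨x, hx, hxK⟩ := h₁
  obtain ⟨w, -, hw, hw'⟩ := hB _ _ isOpen_interior K.isClosed.isOpen_compl
    (fun x hx => by
      by_cases h : x ∈ (K : Set (Euc n))
      · exact Or.inl (hint x hx h)
      · exact Or.inr h) ⟨x, hx, hint x hx hxK⟩ ⟨z, hz, hzK⟩
  exact hw' (interior_subset hw)

open Filter Topology in
/-- A continuous translation invariant valuation of degree `n` is a multiple of the volume. -/
theorem ValDeg.eq_mul_volume {φ : Body n → ℝ} (hφ : φ ∈ ValDeg n n) (K : Body n) :
    φ K = φ (unitCube n) * volume.real (K : Set (Euc n)) := by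
  obtain ⟨M, hM0, hM⟩ := exists_abs_le_of_continuous hφ.1.2.2 (unitCube n).isCompact
  set c := φ (unitCube n)
  set F := frontier (K : Set (Euc n))
  obtain ⟨R, hR, hKR⟩ := K.isBounded.exists_pos_norm_le
  have hKbox : (K : Set (Euc n)) ⊆ box (fun _ => -R) fun _ => 2 * R := by
    intro x hx i
    have := abs_le.1 ((PiLp.norm_apply_le x i).trans (hKR x hx))
    exact ⟨this.1, by linarith [this.2]⟩
  have hest : ∀ k : ℕ, |φ K - c * volume.real (K : Set (Euc n))| ≤
      (M + |c|) * volume.real (Metric.cthickening (n * (2 * R / 2 ^ k)) F) := by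
    intro k
    set r : ℝ := 2 * R / 2 ^ k
    have hr : 0 < r := by positivity
    set T := Metric.cthickening (n * r) F
    have hTfin : volume T ≠ ⊤ := by
      refine (Bornology.IsBounded.measure_lt_top ?_).ne
      exact (K.isBounded.subset (K.isClosed.frontier_subset)).cthickening
    have hbfin : ∀ a b, volume (box a b : Set (Euc n)) ≠ ⊤ := fun a b =>
      (isCompact_box a b).measure_lt_top.ne
    -- The error bound is additive under cuts, so it suffices to check it on cubes of side r. Cubes
    -- missing K or inside K have no error; a cube meeting the boundary lies in T, since its
    -- diameter is at most nr.
    have main := cube_induction (G := fun B : Set (Euc n) =>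
      |extendZero φ (B ∩ K) - c * volume.real (B ∩ K)| ≤ (M + |c|) * volume.real (B ∩ T))
      (r := r) ?_ hr.le ?_ k (fun _ => -R)
    · have h1 : (2 : ℝ) ^ k * r = 2 * R := by simp only [r]; field_simp
      rw [h1, Set.inter_eq_right.2 hKbox, extendZero_coe] at main
      refine main.trans ?_
      gcongr
      exact Set.inter_subset_right
    · intro a b i s h₁ h₂
      have hi := single_one_ne_zero i
      have e1 := extendZero_cut hφ hi s ((convex_box a b).inter K.convex)
        ((isCompact_box a b).inter_right K.isClosed)
      have e2 := volume_real_cut hi s ((isClosed_box a b).inter K.isClosed).measurableSet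
        (measure_ne_top_of_subset Set.inter_subset_left (hbfin a b))
      have e3 := volume_real_cut hi s
        ((isClosed_box a b).inter (Metric.isClosed_cthickening (δ := n * r) (E := F))).measurableSet
        (measure_ne_top_of_subset Set.inter_subset_left (hbfin a b))
      rw [Set.inter_right_comm, Set.inter_right_comm _ (K : Set (Euc n))] at e1 e2
      rw [Set.inter_right_comm, Set.inter_right_comm _ (Metric.cthickening _ _)] at e3
      rw [e1, e2, e3]
      refine (le_of_eq_of_le (congrArg _ (by ring)) (abs_add_le _ _)).trans
        ((add_le_add h₁ h₂).trans_eq (by ring))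
    · intro a
      set B : Set (Euc n) := box a fun _ => r
      rcases (B ∩ K).eq_empty_or_nonempty with h₁ | h₁
      · rw [h₁, extendZero_empty, measureReal_empty, mul_zero, sub_zero, abs_zero]
        positivity
      by_cases h₂ : B ⊆ (K : Set (Euc n))
      · rw [Set.inter_eq_left.2 h₂, ValDeg.box_eq hφ a hr, volume_real_box a hr.le, mul_comm,
          sub_self, abs_zero]
        positivity
      · obtain ⟨z, hz, hzF⟩ := inter_frontier_nonempty (convex_box a _).isPreconnected h₁ h₂
        have hBT : B ⊆ T := fun x hx => Metric.mem_cthickening_of_dist_le x z _ _ hzF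
          (dist_le_of_mem_box hr.le hx hz)
        rw [Set.inter_eq_left.2 hBT, volume_real_box a hr.le]
        have h3 := ValDeg.abs_extendZero_le hφ hM0 hM hr
          (Set.inter_subset_left : B ∩ (K : Set (Euc n)) ⊆ B)
        have h4 : volume.real (B ∩ K) ≤ r ^ n := by
          rw [← volume_real_box a hr.le]
          exact measureReal_mono Set.inter_subset_left (hbfin _ _)
        calc _ ≤ |extendZero φ (B ∩ K)| + |c * volume.real (B ∩ K)| := abs_sub _ _
          _ ≤ r ^ n * M + |c| * r ^ n := by
            rw [abs_mul, abs_of_nonneg (measureReal_nonneg (μ := volume) (s := B ∩ K))]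
            gcongr
          _ = (M + |c|) * r ^ n := by ring
  have hF0 : volume F = 0 := K.convex.addHaar_frontier volume
  have hthick : Tendsto (fun δ => volume (Metric.cthickening δ F)) (𝓝 0) (𝓝 (volume F)) := by
    refine tendsto_measure_cthickening_of_isClosed ⟨1, one_pos, ?_⟩ isClosed_frontier
    exact (Bornology.IsBounded.measure_lt_top
      (K.isBounded.subset (K.isClosed.frontier_subset)).cthickening).ne
  have hδ : Tendsto (fun k : ℕ => n * (2 * R / 2 ^ k)) atTop (𝓝 0) := by
    have := (tendsto_pow_atTop_nhds_zero_of_lt_one (r := (1 / 2 : ℝ)) (by norm_num)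
      (by norm_num)).const_mul (n * (2 * R))
    rw [mul_zero] at this
    refine this.congr fun k => ?_
    rw [one_div, inv_pow]; ring
  have hlim : Tendsto (fun k : ℕ =>
      (M + |c|) * volume.real (Metric.cthickening (n * (2 * R / 2 ^ k)) F)) atTop (𝓝 0) := by
    have h1 := (ENNReal.tendsto_toReal (by rw [hF0]; simp)).comp (hthick.comp hδ)
    rw [hF0, ENNReal.toReal_zero] at h1
    have h2 := h1.const_mul (M + |c|)
    rw [mul_zero] at h2
    exact h2
  have h0 := ge_of_tendsto' hlim hest
  exact sub_eq_zero.1 (abs_nonpos_iff.1 h0)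

end TopDegree

/-! ### Support functions, sublinear functions and widths -/

section SupportFunction

variable {n : ℕ}

/-- The support function of a convex body. -/
noncomputable def supp (K : Body n) (u : Euc n) : ℝ :=
  sSup ((fun x => ⟪u, x⟫) '' (K : Set (Euc n)))

theorem exists_inner_eq_supp (K : Body n) (u : Euc n) :
    ∃ x ∈ (K : Set (Euc n)), ⟪u, x⟫ = supp K u := by
  obtain ⟨x, hx, h, -⟩ := K.isCompact.exists_sSup_image_eq_and_ge K.nonempty
    (f := fun x : Euc n => ⟪u, x⟫) (by fun_prop)
  exact ⟨x, hx, h.symm⟩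

theorem inner_le_supp {K : Body n} {x : Euc n} (hx : x ∈ (K : Set (Euc n))) (u : Euc n) :
    ⟪u, x⟫ ≤ supp K u :=
  le_csSup (K.isCompact.image (by fun_prop)).bddAbove ⟨x, hx, rfl⟩

theorem supp_le {K : Body n} {u : Euc n} {c : ℝ} (h : ∀ x ∈ (K : Set (Euc n)), ⟪u, x⟫ ≤ c) :
    supp K u ≤ c := by
  obtain ⟨x, hx, hxu⟩ := exists_inner_eq_supp K u
  exact hxu ▸ h x hx

theorem supp_add (K L : Body n) (u : Euc n) : supp (K + L) u = supp K u + supp L u := by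
  apply le_antisymm
  · refine supp_le ?_
    rintro _ ⟨x, hx, y, hy, rfl⟩
    simp only [inner_add_right]
    exact add_le_add (inner_le_supp hx u) (inner_le_supp hy u)
  · obtain ⟨x, hx, hxu⟩ := exists_inner_eq_supp K u
    obtain ⟨y, hy, hyu⟩ := exists_inner_eq_supp L u
    rw [← hxu, ← hyu, ← inner_add_right]
    exact inner_le_supp (K := K + L) ⟨x, hx, y, hy, rfl⟩ u

theorem supp_smul (K : Body n) {t : ℝ} (ht : 0 ≤ t) (u : Euc n) :
    supp (t • K) u = t * supp K u := by
  apply le_antisymm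
  · refine supp_le ?_
    rintro _ ⟨x, hx, rfl⟩
    simp only [inner_smul_right]
    exact mul_le_mul_of_nonneg_left (inner_le_supp hx u) ht
  · obtain ⟨x, hx, hxu⟩ := exists_inner_eq_supp K u
    rw [← hxu, ← inner_smul_right]
    exact inner_le_supp (K := t • K) ⟨x, hx, rfl⟩ u

theorem supp_zero (u : Euc n) : supp (0 : Body n) u = 0 := by
  obtain ⟨x, hx, hxu⟩ := exists_inner_eq_supp (0 : Body n) u
  rw [ConvexBody.coe_zero, Set.mem_zero] at hx
  rw [← hxu, hx, inner_zero_right]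

theorem supp_sum {ι : Type*} (s : Finset ι) (K : ι → Body n) (u : Euc n) :
    supp (∑ i ∈ s, K i) u = ∑ i ∈ s, supp (K i) u := by
  classical
  induction s using Finset.induction_on with
  | empty => exact supp_zero u
  | insert i s hi ih => rw [Finset.sum_insert hi, Finset.sum_insert hi, supp_add, ih]

theorem supp_add_right_le (K : Body n) (u v : Euc n) : supp K (u + v) ≤ supp K u + supp K v :=
  supp_le fun x hx => by
    rw [inner_add_left]
    exact add_le_add (inner_le_supp hx u) (inner_le_supp hx v)

theorem supp_smul_right (K : Body n) {s : ℝ} (hs : 0 ≤ s) (u : Euc n) :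
    supp K (s • u) = s * supp K u := by
  apply le_antisymm
  · refine supp_le fun x hx => ?_
    rw [real_inner_smul_left]
    exact mul_le_mul_of_nonneg_left (inner_le_supp hx u) hs
  · obtain ⟨x, hx, hxu⟩ := exists_inner_eq_supp K u
    rw [← hxu, ← real_inner_smul_left]
    exact inner_le_supp hx _

theorem continuous_supp (u : Euc n) : Continuous fun K : Body n => supp K u := by
  refine (LipschitzWith.of_le_add_mul ‖u‖₊ fun K L => supp_le fun x hx => ?_).continuous
  obtain ⟨y, hy, hxy⟩ := exists_dist_le_of_body_dist K L hx
  have h1 : ⟪u, x⟫ = ⟪u, y⟫ + ⟪u, x - y⟫ := by rw [← inner_add_right, add_sub_cancel]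
  have h2 : ⟪u, x - y⟫ ≤ ‖u‖ * dist K L := by
    refine (real_inner_le_norm _ _).trans ?_
    rw [← dist_eq_norm]
    gcongr
  rw [h1, coe_nnnorm]
  exact add_le_add (inner_le_supp hy u) h2

theorem subset_of_supp_le {K L : Body n} (h : ∀ u, supp K u ≤ supp L u) :
    (K : Set (Euc n)) ⊆ L := by
  intro x hx
  by_contra hxL
  obtain ⟨f, c, hf, hfx⟩ := geometric_hahn_banach_closed_point L.convex L.isClosed hxL
  obtain ⟨y, hy, hyu⟩ := exists_inner_eq_supp L ((InnerProductSpace.toDual ℝ (Euc n)).symm f)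
  have h1 := (inner_le_supp hx _).trans (h ((InnerProductSpace.toDual ℝ (Euc n)).symm f))
  rw [← hyu, InnerProductSpace.toDual_symm_apply, InnerProductSpace.toDual_symm_apply] at h1
  linarith [hf y hy]

theorem eq_of_supp_eq {K L : Body n} (h : ∀ u, supp K u = supp L u) : K = L :=
  ConvexBody.ext <| (subset_of_supp_le fun u => (h u).le).antisymm
    (subset_of_supp_le fun u => (h u).ge)

/-- Every sublinear function is the support function of a convex body. -/
theorem exists_body_supp_eq {f : Euc n → ℝ} (hadd : ∀ u v, f (u + v) ≤ f u + f v)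
    (hsmul : ∀ s : ℝ, 0 ≤ s → ∀ u, f (s • u) = s * f u) : ∃ K : Body n, ∀ u, supp K u = f u := by
  have hf0 : f 0 = 0 := by simpa using hsmul 0 le_rfl 0
  let S : Set (Euc n) := {x | ∀ u, ⟪u, x⟫ ≤ f u}
  have hS : S = ⋂ u, {x | ⟪u, x⟫ ≤ f u} := by ext x; simp [S]
  have hconv : Convex ℝ S := by
    rw [hS]
    exact convex_iInter fun u => convex_halfSpace_le (innerₛₗ ℝ u).isLinear (f u)
  have hclosed : IsClosed S := by
    rw [hS]
    exact isClosed_iInter fun u => isClosed_le (by fun_prop) continuous_const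
  have hcompact : IsCompact S := by
    let a : Fin n → ℝ := fun i => -f (-EuclideanSpace.single i 1)
    let b : Fin n → ℝ := fun i => f (EuclideanSpace.single i 1)
    refine (isCompact_box a (b - a)).of_isClosed_subset hclosed fun x hx i => ?_
    have h1 := hx (EuclideanSpace.single i 1)
    have h2 := hx (-EuclideanSpace.single i 1)
    rw [inner_neg_left, inner_single_one] at h2
    rw [inner_single_one] at h1
    simp only [a, b, Pi.sub_apply]
    constructor <;> linarith
  -- Hahn–Banach: a functional dominated by f extends to the whole space, and the vector
  -- representing it lies in S.
  have hext : ∀ p : Euc n →ₗ.[ℝ] ℝ, (∀ x : p.domain, p x ≤ f x) →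
      ∃ x ∈ S, ∀ u : p.domain, ⟪(u : Euc n), x⟫ = p u := by
    intro p hp
    obtain ⟨g, hg, hgf⟩ := exists_extension_of_le_sublinear p f
      (fun c hc x => hsmul c hc.le x) hadd hp
    have key : ∀ u, ⟪u, (InnerProductSpace.toDual ℝ (Euc n)).symm
        (LinearMap.toContinuousLinearMap g)⟫ = g u := fun u => by
      rw [real_inner_comm, InnerProductSpace.toDual_symm_apply]; rfl
    exact ⟨_, fun u => (key u).trans_le (hgf u), fun u => (key u).trans (hg u)⟩
  have hattain : ∀ u, ∃ x ∈ S, ⟪u, x⟫ = f u := by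
    intro u
    rcases eq_or_ne u 0 with rfl | hu
    · obtain ⟨x, hx, -⟩ := hext ⊥ fun x => by
        have : (x : Euc n) = 0 := (Submodule.mem_bot ℝ).1 x.2
        rw [this, hf0]
        have h2 : x = 0 := Subtype.ext this
        rw [h2, LinearPMap.map_zero]
      exact ⟨x, hx, by rw [inner_zero_left, hf0]⟩
    · obtain ⟨x, hx, hxu⟩ := hext (LinearPMap.mkSpanSingleton u (f u) hu) fun x => by
        obtain ⟨x, hx⟩ := x
        obtain ⟨c, rfl⟩ := Submodule.mem_span_singleton.1 hx
        rw [LinearPMap.mkSpanSingleton'_apply]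
        simp only [smul_eq_mul, RingHom.id_apply]
        rcases le_total 0 c with hc | hc
        · rw [hsmul c hc]
        -- For negative multiples, subadditivity gives 0 ≤ f(cu) + f(-cu), that is, c f(u) ≤ f(cu).
        · have h1 := hadd (c • u) ((-c) • u)
          rw [hsmul (-c) (neg_nonneg.2 hc), ← add_smul, add_neg_cancel, zero_smul, hf0] at h1
          linarith
      refine ⟨x, hx, ?_⟩
      have := hxu ⟨u, Submodule.mem_span_singleton_self u⟩
      rwa [LinearPMap.mkSpanSingleton_apply] at this
  obtain ⟨x₀, hx₀, -⟩ := hattain 0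
  refine ⟨⟨S, hconv, hcompact, ⟨x₀, hx₀⟩⟩, fun u => le_antisymm (supp_le fun x hx => hx u) ?_⟩
  obtain ⟨x, hx, hxu⟩ := hattain u
  rw [← hxu]
  exact inner_le_supp (K := ⟨S, hconv, hcompact, ⟨x₀, hx₀⟩⟩) hx u

/-- The sum of the support values in two opposite directions. -/
noncomputable def width (u : Euc n) (K : Body n) : ℝ := supp K u + supp K (-u)

/-- A single support value can be negative; the width is the Minkowski-additive quantity from which
signs of coefficients are read off. -/
theorem width_nonneg (u : Euc n) (K : Body n) : 0 ≤ width u K := by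
  obtain ⟨x, hx⟩ := K.nonempty
  have h1 := inner_le_supp hx u
  have h2 := inner_le_supp hx (-u)
  rw [inner_neg_left] at h2
  rw [width]
  linarith

theorem width_add (u : Euc n) (K L : Body n) : width u (K + L) = width u K + width u L := by
  simp only [width, supp_add]; ring

theorem width_smul (u : Euc n) {t : ℝ} (ht : 0 ≤ t) (K : Body n) :
    width u (t • K) = t * width u K := by
  simp only [width, supp_smul K ht]; ring

theorem width_sum {ι : Type*} (s : Finset ι) (u : Euc n) (K : ι → Body n) :
    width u (∑ i ∈ s, K i) = ∑ i ∈ s, width u (K i) := by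
  simp only [width, supp_sum, Finset.sum_add_distrib]

/-- The closed unit ball. -/
def unitBall (n : ℕ) : Body n :=
  ⟨Metric.closedBall 0 1, convex_closedBall 0 1, isCompact_closedBall 0 1, ⟨0, by simp⟩⟩

theorem width_unitBall_pos (i : Fin n) : 0 < width (EuclideanSpace.single i 1) (unitBall n) := by
  have h1 : EuclideanSpace.single i 1 ∈ (unitBall n : Set (Euc n)) :=
    mem_closedBall_zero_iff.2 (by simp)
  have h2 : -EuclideanSpace.single i 1 ∈ (unitBall n : Set (Euc n)) :=
    mem_closedBall_zero_iff.2 (by simp)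
  have h3 := inner_le_supp h1 (EuclideanSpace.single i 1)
  have h4 := inner_le_supp h2 (-EuclideanSpace.single i 1)
  rw [inner_neg_neg] at h4
  rw [inner_single_one] at h3 h4
  simp only [PiLp.single_apply, if_true] at h3 h4
  rw [width]
  linarith

end SupportFunction

/-! ### Non-negative components versus Minkowski expansions -/

section Expansion

variable {n : ℕ}

theorem sum_range_succ_eq_add_sum_Icc_add {m : ℕ} (hm : 1 ≤ m) (f : ℕ → ℝ) :
    ∑ i ∈ Finset.range (m + 1), f i = f 0 + ∑ i ∈ Finset.Icc 1 (m - 1), f i + f m := by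
  rw [Finset.sum_range_succ, Finset.range_eq_Ico, Finset.sum_eq_sum_Ico_succ_bot hm]
  congr 3

theorem MVal.supp_mem_val {Φ : Body n → Body n} (hΦ : Φ ∈ MVal n) (u : Euc n) :
    (fun K => supp (Φ K) u) ∈ Val n :=
  ⟨fun K L U I hU hI => by rw [← supp_add, hΦ.1 K L U I hU hI, supp_add],
    fun K x => by simp only [hΦ.2.1 K x], (continuous_supp u).comp hΦ.2.2⟩

/-- Non-negativity is essential: sB + tB = (s + t)B relies on s, t ≥ 0. -/
theorem Val.smul_body_mem_mVal {φ : Body n → ℝ} (hφ : φ ∈ Val n) (h0 : ∀ K, 0 ≤ φ K)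
    (B : Body n) : (fun K => φ K • B) ∈ MVal n := by
  have hadd : ∀ s t : ℝ, 0 ≤ s → 0 ≤ t → s • B + t • B = (s + t) • B := fun s t hs ht =>
    ConvexBody.ext (by
      simp only [ConvexBody.coe_add, ConvexBody.coe_smul, B.convex.add_smul hs ht])
  refine ⟨fun K L U I hU hI => ?_, fun K x => by simp only [hφ.2.1 K x],
    (continuous_smul_const_body B).comp hφ.2.2⟩
  rw [hadd _ _ (h0 _) (h0 _), hadd _ _ (h0 _) (h0 _), hφ.1 K L U I hU hI]

theorem hasNonnegComponents_of_hasBodyExpansion (hn : 1 ≤ n) {K : Body n}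
    (h : ∀ Φ : MVal n, ∃ M₀ Mₙ : Body n, HasBodyExpansion Φ.1 K M₀ Mₙ) :
    HasNonnegComponents K := by
  intro φ hφ h0 ψ hψ i
  obtain ⟨M₀, Mₙ, Ψ, hΨ⟩ := h ⟨_, Val.smul_body_mem_mVal hφ h0 (unitBall n)⟩
  let e : Euc n := EuclideanSpace.single ⟨0, hn⟩ 1
  have hw : 0 < width e (unitBall n) := width_unitBall_pos _
  set V := volume.real (K : Set (Euc n))
  -- The coefficients of the width of φ(tK)B, computed from φ and from the expansion; the default 0
  -- beyond n is never read.
  let a : ℕ → ℝ := fun j => if h : j < n + 1 then ψ ⟨j, h⟩ K * width e (unitBall n) else 0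
  let b : ℕ → ℝ := fun j =>
    if j = 0 then width e M₀ else if j = n then V * width e Mₙ else width e (Ψ j)
  have hb : ∀ j, 0 ≤ b j := fun j => by
    simp only [b]
    split_ifs
    · exact width_nonneg _ _
    · exact mul_nonneg measureReal_nonneg (width_nonneg _ _)
    · exact width_nonneg _ _
  have hab : a i = b i := by
    refine coeff_eq_of_eval_eq (n := n) (fun t ht => ?_) (Nat.lt_succ_iff.1 i.2)
    have h1 := congrArg (width e) (hΨ t ht)
    simp only [width_smul e (h0 _), width_add, width_sum] at h1
    rw [width_smul e (mul_nonneg (by positivity) measureReal_nonneg), hψ.2 K t ht,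
      Finset.sum_mul] at h1
    have h2 : ∑ j ∈ Finset.range (n + 1), t ^ j * a j =
        ∑ j : Fin (n + 1), t ^ (j : ℕ) * ψ j K * width e (unitBall n) := by
      rw [Finset.sum_range]
      exact Finset.sum_congr rfl fun j _ => by
        rw [show a j = ψ j K * width e (unitBall n) from dif_pos j.2, mul_assoc]
    rw [h2, h1, sum_range_succ_eq_add_sum_Icc_add hn]
    congr 1
    · congr 1
      · simp [b]
      · refine Finset.sum_congr rfl fun j hj => ?_
        rw [Finset.mem_Icc] at hj
        rw [width_smul e (by positivity)]
        simp only [b]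
        rw [if_neg (by omega), if_neg (by omega)]
    · simp only [b]
      rw [if_neg (by omega), if_pos trivial, mul_assoc]
  have ha : a i = ψ i K * width e (unitBall n) := dif_pos i.2
  have := hb i
  rw [← hab, ha] at this
  exact nonneg_of_mul_nonneg_left this hw

-- The top component is the limit of s ^ n φ(s⁻¹K) as s → 0+, for every K. Hence the degree n part
-- yields a body without assuming (a).
open Filter Topology in
theorem Val.homComponent_top_nonneg {φ : Body n → ℝ} (hφ : φ ∈ Val n) (h0 : ∀ K, 0 ≤ φ K)
    (K : Body n) : 0 ≤ homComponent n φ K := by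
  have h2 : Tendsto (fun s : ℝ => ∑ i ∈ Finset.range (n + 1), s ^ (n - i) * homComponent i φ K)
      (𝓝[>] 0) (𝓝 (homComponent n φ K)) := by
    have hc : Continuous fun s : ℝ =>
      ∑ i ∈ Finset.range (n + 1), s ^ (n - i) * homComponent i φ K := by fun_prop
    have := hc.tendsto 0
    rw [Finset.sum_eq_single_of_mem n (by simp) fun i hi hi' => by
      rw [Finset.mem_range] at hi
      rw [zero_pow (by omega), zero_mul], Nat.sub_self, pow_zero, one_mul] at this
    exact this.mono_left nhdsWithin_le_nhds
  refine ge_of_tendsto h2 ?_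
  filter_upwards [self_mem_nhdsWithin] with s hs
  have hs' : (0 : ℝ) < s := hs
  have h3 : ∑ i ∈ Finset.range (n + 1), s ^ (n - i) * homComponent i φ K =
      s ^ n * φ (s⁻¹ • K) := by
    rw [Val.eq_sum_homComponent hφ K (inv_pos.2 hs'), Finset.mul_sum]
    refine Finset.sum_congr rfl fun i hi => ?_
    rw [← mul_assoc, inv_pow, pow_sub₀ _ hs'.ne' (Nat.lt_succ_iff.1 (Finset.mem_range.1 hi))]
  rw [h3]
  exact mul_nonneg (by positivity) (h0 _)

/-- If the components of degree `i` of non-negative valuations are non-negative at `K`, then for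
`Φ ∈ MVal n` those of the support functions `K ↦ supp (Φ K) u` are the support function of a
convex body. -/
theorem MVal.exists_body_supp_eq_homComponent {Φ : Body n → Body n} (hΦ : Φ ∈ MVal n) {i : ℕ}
    {K : Body n} (h : ∀ φ ∈ Val n, (∀ L : Body n, 0 ≤ φ L) → 0 ≤ homComponent i φ K) :
    ∃ L : Body n, ∀ u, supp L u = homComponent i (fun A => supp (Φ A) u) K := by
  refine exists_body_supp_eq (fun u v => ?_) fun s hs u => ?_
  · have hmem := Val.add (Val.add (MVal.supp_mem_val hΦ u) (MVal.supp_mem_val hΦ v))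
      (Val.const_mul (MVal.supp_mem_val hΦ (u + v)) (-1))
    have := h _ hmem fun A => by linarith [supp_add_right_le (Φ A) u v]
    rw [homComponent_add, homComponent_add, homComponent_const_mul] at this
    linarith
  · simp only [supp_smul_right _ hs]
    exact homComponent_const_mul i s _ K

/-- The body `Lₙ` in the expansion of `Φ`. -/
noncomputable def topBody (Φ : MVal n) : Body n :=
  (MVal.exists_body_supp_eq_homComponent Φ.2 (i := n) (K := unitCube n)
    fun _ hφ h0 => Val.homComponent_top_nonneg hφ h0 _).choose

theorem supp_topBody (Φ : MVal n) (u : Euc n) :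
    supp (topBody Φ) u = homComponent n (fun A => supp (Φ.1 A) u) (unitCube n) :=
  (MVal.exists_body_supp_eq_homComponent Φ.2 (i := n) (K := unitCube n)
    fun _ hφ h0 => Val.homComponent_top_nonneg hφ h0 _).choose_spec u

theorem HasNonnegComponents.hasBodyExpansion (hn : 1 ≤ n) {K : Body n}
    (hK : HasNonnegComponents K) (Φ : MVal n) : HasBodyExpansion Φ.1 K (Φ.1 0) (topBody Φ) := by
  have hex : ∀ i : ℕ, ∃ L : Body n, i ≤ n →
      ∀ u, supp L u = homComponent i (fun A => supp (Φ.1 A) u) K := by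
    intro i
    by_cases hi : i ≤ n
    · obtain ⟨L, hL⟩ := MVal.exists_body_supp_eq_homComponent Φ.2 (i := i) (K := K)
        fun φ hφ h0 => hK φ hφ h0 _ (Val.isHomogeneousComponents hφ) ⟨i, Nat.lt_succ_iff.2 hi⟩
      exact ⟨L, fun _ => hL⟩
    · exact ⟨0, fun h => absurd h hi⟩
  choose Ψ hΨ using hex
  refine ⟨Ψ, fun t ht => eq_of_supp_eq fun u => ?_⟩
  have hφ := MVal.supp_mem_val Φ.2 u
  rw [supp_add, supp_add, supp_sum, supp_smul _ (mul_nonneg (by positivity) measureReal_nonneg),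
    supp_topBody, Val.eq_sum_homComponent hφ K ht, sum_range_succ_eq_add_sum_Icc_add hn]
  congr 1
  · congr 1
    · rw [pow_zero, one_mul, Val.homComponent_zero hφ]
    · refine Finset.sum_congr rfl fun i hi => ?_
      rw [Finset.mem_Icc] at hi
      rw [supp_smul _ (by positivity), hΨ i (by omega)]
  -- The top component at K is its value at the unit cube times V(K), which is why one body serves
  -- all K.
  · rw [ValDeg.eq_mul_volume (Val.homComponent_mem_valDeg hφ le_rfl) K]
    ring

end Expansion

theorem lemma4p1 (n : ℕ) (hn : 3 ≤ n) :
    ∃ L₀ Lₙ : MVal n → Body n, ∀ K : Body n,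
      (HasNonnegComponents K ↔ ∀ Φ : MVal n, HasBodyExpansion Φ.1 K (L₀ Φ) (Lₙ Φ)) ∧
      (HasNonnegComponents K ↔
        ∀ Φ : MVal n, ∃ M₀ Mₙ : Body n, HasBodyExpansion Φ.1 K M₀ Mₙ) := by
  have hn1 : 1 ≤ n := by omega
  refine ⟨fun Φ => Φ.1 0, topBody, fun K =>
    ⟨⟨fun h Φ => h.hasBodyExpansion hn1 Φ, fun h => ?_⟩,
      ⟨fun h Φ => ⟨_, _, h.hasBodyExpansion hn1 Φ⟩, hasNonnegComponents_of_hasBodyExpansion hn1⟩⟩⟩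
  exact hasNonnegComponents_of_hasBodyExpansion hn1 fun Φ => ⟨_, _, h Φ⟩
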